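/- Let $n\ge 2$ and let $f:\mathbb{R}^n\to[0,\infty)$ be (the $1$-homogeneous extension of) a crystalline surface tension: $f$ is convex, $1$-homogeneous, piecewise linear (the maximum of finitely many linear functions), and positive away from the origin. Let $K=\{x : \langle x,\nu\rangle<f(\nu)\ \text{for all}\ \nu\in S^{n-1}\}$ be its Wulff shape, a polytope, let $\nu_1,\dots,\nu_N$ be the outer unit normals of the facets of $K$, and put $d_i=f(\nu_i)$. Put $\epsilon_\Phi=\inf_{S^{n-1}}f/\sup_{S^{n-1}}f$, $f_*(x)=\sup\{\langle x,\nu\rangle : f(\nu)\le 1\}$ and $$\gamma_\Phi(E)=\sup_{y\in\mathbb{R}^n}\int_E\frac{dx}{f_*(x-y)}.$$ For $\mathbf a\in\mathbb{R}^N$ with $\|\mathbf a\|_{\ell^\infty}<1$ let $K^{\mathbf a}=\bigcap_{i}\{x:\langle x,\nu_i\rangle<d_i(1+\mathbf a_i)\}$ and $F_i^{\mathbf a}=\partial K^{\mathbf a}\cap\{x:\langle x,\nu_i\rangle=d_i(1+\mathbf a_i)\}$; $K^{\mathbf a}$ is parallel to $K$ if each $F_i^{\mathbf a}$ is a facet (has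 dimension $n-1$). Fix $r_0>0$ and $0<c_0<1/2$. A set of finite perimeter $E\subset\mathbb{R}^n$ with reduced boundary $\partial^*E$ satisfies the uniform density estimate if $$c_0\epsilon_\Phi^n\,\omega_n r^n\le |B_r(x)\cap E|\le (1-c_0\epsilon_\Phi^n)\,\omega_n r^n\qquad\text{for all } x\in\partial^*E,\ 0<r<r_0,$$ where $\omega_n$ is the volume of the unit ball. There is $\epsilon_0>0$, depending only on $n$, $K$ and the constants $r_0,c_0$ of the density estimate, such that for every set of finite perimeter $E\subset\mathbb{R}^n$ that satisfies the uniform density estimate, $|E|=|K|$ and $|E\Delta K|\le\epsilon_0$, the following holds. There is exactly one $\mathbf a=\mathbf a^*$ for which $K^{\mathbf a}$ is parallel to $K$, $|K^{\mathbf a}|=|K|$, and $$|E\cap\mathrm{Cone}(F_i^{\mathbf a})|=|K^{\mathbf a}\cap\mathrm{Cone}(F_i^{\mathbf a})|\quad\text{for every } i,$$ where $\mathrm{Cone}(F)=\{tx : t\ge 0,\ x\in F\}$ (so $K^{\mathbf a^*}$ is the projection of $E$ onto the polytopes parallel to $K$ of volume $|K|$), and $$|\gamma_\Phi(E)-\gamma_\Phi(K^{\mathbf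 a^*})|\le\tfrac12\,|E\Delta K^{\mathbf a^*}|.$$ -/

import Mathlib

open MeasureTheory Metric Set Filter Topology
open scoped symmDiff

noncomputable section

namespace Crystal

/-- Euclidean space of dimension `n`. -/
abbrev Eu (n : ℕ) : Type := EuclideanSpace ℝ (Fin n)

/-! ### Sets of finite perimeter and the reduced boundary -/

/-- The divergence of a vector field. -/
def divergence {n : ℕ} (T : Eu n → Eu n) (x : Eu n) : ℝ :=
  LinearMap.trace ℝ (Eu n) (fderiv ℝ T x : Eu n →ₗ[ℝ] Eu n)

/-- `ν μ` is the polar decomposition of the (finite) Gauss-Green measure of `E`: `μ` is its total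
variation, `ν` its density with respect to the total variation (the outer unit normal). -/
structure IsGaussGreen {n : ℕ} (E : Set (Eu n)) (μ : Measure (Eu n)) (ν : Eu n → Eu n) :
    Prop where
  finite : IsFiniteMeasure μ
  meas : AEStronglyMeasurable ν μ
  unit : ∀ᵐ x ∂μ, ‖ν x‖ = 1
  gauss_green : ∀ T : Eu n → Eu n, ContDiff ℝ 1 T → HasCompactSupport T →
    ∫ x in E, divergence T x = ∫ x, inner ℝ (T x) (ν x) ∂μ

/-- Sets of finite perimeter: Lebesgue measurable sets whose indicator has a finite vector-valued
measure as its distributional gradient. -/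
def HasFinitePerimeter {n : ℕ} (E : Set (Eu n)) : Prop :=
  NullMeasurableSet E volume ∧ ∃ μ ν, IsGaussGreen E μ ν

/-- De Giorgi's reduced boundary: the points of the support of the total variation of the
Gauss-Green measure at which the averages of the normal converge to a unit vector. -/
def reducedBoundary {n : ℕ} (E : Set (Eu n)) : Set (Eu n) :=
  {x | ∃ μ ν, IsGaussGreen E μ ν ∧ (∀ r : ℝ, 0 < r → 0 < μ (ball x r)) ∧
    ∃ v : Eu n, ‖v‖ = 1 ∧
      Tendsto (fun r : ℝ => ⨍ y in closedBall x r, ν y ∂μ) (𝓝[>] 0) (𝓝 v)}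

/-! ### Crystalline surface tensions -/

/-- `f` is (the 1-homogeneous extension to the whole space of) a crystalline surface tension:
positive away from the origin, convex and piecewise linear, that is, the maximum of finitely many
linear functions. -/
def IsCrystalline {n : ℕ} (f : Eu n → ℝ) : Prop :=
  (∀ x, x ≠ 0 → 0 < f x) ∧
    ∃ V : Finset (Eu n), ∀ x, IsGreatest ((fun v => inner ℝ v x) '' (V : Set (Eu n))) (f x)

/-- The gauge function `f_*`. -/
def dualGauge {n : ℕ} (f : Eu n → ℝ) (x : Eu n) : ℝ :=
  sSup {t : ℝ | ∃ ν : Eu n, f ν ≤ 1 ∧ t = inner ℝ x ν}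

/-- The eccentricity: the infimum of `f` over the unit sphere divided by its supremum. -/
def eccentricity {n : ℕ} (f : Eu n → ℝ) : ℝ :=
  sInf (f '' sphere 0 1) / sSup (f '' sphere 0 1)

/-- `γ_Φ(E)`. For `n ≥ 2` and `|E| < ∞` the integrals converge and are bounded in `y`. -/
def gammaPhi {n : ℕ} (f : Eu n → ℝ) (E : Set (Eu n)) : ℝ :=
  ⨆ y : Eu n, ∫ x in E, 1 / dualGauge f (x - y)

/-- The uniform density estimate with constants `r₀`, `c₀`; `|B_r(x)|` stands for `ω_n r ^ n`. -/
def UniformDensity {n : ℕ} (f : Eu n → ℝ) (r₀ c₀ : ℝ) (E : Set (Eu n)) : Prop :=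
  ∀ x ∈ reducedBoundary E, ∀ r : ℝ, 0 < r → r < r₀ →
    c₀ * eccentricity f ^ n * volume.real (ball x r) ≤ volume.real (ball x r ∩ E) ∧
      volume.real (ball x r ∩ E) ≤ (1 - c₀ * eccentricity f ^ n) * volume.real (ball x r)

/-! ### The Wulff shape and its parallel polytopes -/

/-- The Wulff shape `K` of `f`. -/
def wulff {n : ℕ} (f : Eu n → ℝ) : Set (Eu n) :=
  {x | ∀ ν : Eu n, ‖ν‖ = 1 → inner ℝ x ν < f ν}

/-- The face of a convex set `P` in the hyperplane `⟨x, ν⟩ = h`. -/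
def face {n : ℕ} (P : Set (Eu n)) (ν : Eu n) (h : ℝ) : Set (Eu n) :=
  frontier P ∩ {x | inner ℝ x ν = h}

/-- Being of affine dimension `n - 1`. -/
def FacetDim {n : ℕ} (F : Set (Eu n)) : Prop :=
  Module.finrank ℝ (vectorSpan ℝ F) + 1 = n

/-- The set of the unit normals `ν_i` of the facets of the Wulff shape. It is used as the index set
of the facets; the facet with normal `ν_i` has distance `d_i = f ν_i` from the origin. -/
def facetNormals {n : ℕ} (f : Eu n → ℝ) : Set (Eu n) :=
  {ν | ‖ν‖ = 1 ∧ FacetDim (face (wulff f) ν (f ν))}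

/-- The perturbed polytope `K^a`. -/
def perturbed {n : ℕ} (f : Eu n → ℝ) (a : facetNormals f → ℝ) : Set (Eu n) :=
  {x | ∀ i : facetNormals f, inner ℝ x (i : Eu n) < f i * (1 + a i)}

/-- The part `F_i^a` of the boundary of `K^a` with normal `ν_i`. -/
def facet {n : ℕ} (f : Eu n → ℝ) (a : facetNormals f → ℝ) (i : facetNormals f) : Set (Eu n) :=
  face (perturbed f a) i (f i * (1 + a i))

/-- `K^a` is parallel to `K`: `‖a‖_∞ < 1`, and every `F_i^a` is still a facet. -/
def IsParallel {n : ℕ} (f : Eu n → ℝ) (a : facetNormals f → ℝ) : Prop :=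
  (∀ i, |a i| < 1) ∧ ∀ i, FacetDim (facet f a i)

/-- The cone over `F` with vertex at the origin. -/
def coneOver {n : ℕ} (F : Set (Eu n)) : Set (Eu n) :=
  {z | ∃ t : ℝ, 0 ≤ t ∧ ∃ x ∈ F, z = t • x}

/-- `K^a` is the projection `K^{a*}` of `E` onto the polytopes parallel to `K` with the volume of
`K`: in the cone over each of its facets it has as much volume as `E`. -/
def IsProjection {n : ℕ} (f : Eu n → ℝ) (E : Set (Eu n)) (a : facetNormals f → ℝ) : Prop :=
  IsParallel f a ∧ volume (perturbed f a) = volume (wulff f) ∧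
    ∀ i, volume (E ∩ coneOver (facet f a i)) = volume (perturbed f a ∩ coneOver (facet f a i))

end Crystal

end

namespace Crystal

/-! ### Gauss-Green measures and constancy away from the reduced boundary -/

section Perimeter

variable {n : ℕ}

/-! Rescale the normals to `w i` = ν_i / f(ν_i). Then K^a is `hpoly w h` with h = 1 + a, K itself is
the case h = 1, and f_* is g = max_i ⟨·, w i⟩, the gauge of K. Three facts about sets close to K are
combined.

Density (`exists_close_ae_eq`). A point of ∂*E well inside K, or well beyond one of its facets,
would by the density estimate force a definite amount of volume into E Δ K. Hence for small ε₀ the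
reduced boundary misses (1-ε)K and the half-spaces ⟨x, w i⟩ > 1 + ε/2. These sets are open and
convex, so E is null or of full measure in each of them (`HasFinitePerimeter.null_or_full`:
mollified indicators have zero gradient there), and closeness in volume decides which. Up to a null
set, E lies between (1-ε)K and (1+ε)K.

Projection (`Irredundant.exists_projection`). The cone over the i-th facet of K^a is `sector w h i`,
and K^a fills in it h_i^n times the volume below ⟨x, w i⟩ = 1. The projections near K are therefore
the fixed points of h ↦ (`ratio w E h i`)^(1/n). For h within η of 1, the numerator and the
denominator of the ratio are volumes of sets that both lie between (1-4η)K and (1+4η)K inside the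
cone. When h varies, the cones change by a set of volume O(dist h h') in K, and the difference of
the two volumes by only O(η) times that. So the map is a contraction for small η. Parallel polytopes
far from K are excluded by the a priori bounds `IsProj.le_one_add` and `IsProj.one_sub_le`, which
makes uniqueness global and places K^{a*} near K.

Potential (`Irredundant.exists_potential_close`). Let E and A have the volume of K and lie close to
it. For small y the function 1/g(x-y) differs from 1 by at most 1/2 on E Δ A; as |E| = |A|,
subtracting 1 from the integrand bounds the difference of the potentials at y by |E Δ A|/2. For y
away from 0 the potential at y does not exceed the one at 0, since E - y contains a ball of fixed
size outside K, where 1/g is definitely smaller than 1. Hence only small y matter for the suprema.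
Apply this with A = K^{a*}. -/

lemma IsGaussGreen.measure_compl_reducedBoundary {E : Set (Eu n)} {μ : Measure (Eu n)}
    {ν : Eu n → Eu n} (h : IsGaussGreen E μ ν) : μ (reducedBoundary E)ᶜ = 0 := by
  have := h.finite
  have hint : Integrable ν μ :=
    Integrable.of_bound h.meas 1 (h.unit.mono fun x hx => hx.le)
  -- Besicovitch differentiation: at μ-almost every x the averages of ν over closed balls tend to ν
  -- x, which is a unit vector.
  have h1 := (Besicovitch.vitaliFamily μ).ae_tendsto_average hint.locallyIntegrable
  have h2 : ∀ᵐ x ∂μ, x ∈ μ.support := Measure.support_mem_ae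
  have h3 : ∀ᵐ x ∂μ, x ∈ reducedBoundary E := by
    filter_upwards [h1, h2, h.unit] with x hx1 hx2 hx3
    exact ⟨μ, ν, h, fun r hr => (Measure.mem_support_iff_forall x).1 hx2 _ (ball_mem_nhds x hr),
      ν x, hx3, hx1.comp (Besicovitch.tendsto_filterAt μ x)⟩
  exact h3

lemma IsGaussGreen.measure_eq_zero {E U : Set (Eu n)} {μ : Measure (Eu n)}
    {ν : Eu n → Eu n} (h : IsGaussGreen E μ ν) (hU : Disjoint U (reducedBoundary E)) : μ U = 0 :=
  measure_mono_null (fun _ hx hx' => hU.le_bot ⟨hx, hx'⟩) h.measure_compl_reducedBoundary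

lemma HasFinitePerimeter.integral_divergence_eq_zero {E U : Set (Eu n)} (h : HasFinitePerimeter E)
    (hU : Disjoint U (reducedBoundary E)) {T : Eu n → Eu n} (hT : ContDiff ℝ 1 T)
    (hc : HasCompactSupport T) (hs : ∀ x, x ∉ U → T x = 0) :
    ∫ x in E, divergence T x = 0 := by
  obtain ⟨_, μ, ν, hg⟩ := h
  rw [hg.gauss_green T hT hc]
  refine integral_eq_zero_of_ae ?_
  have : ∀ᵐ x ∂μ, x ∉ U := by
    rw [ae_iff]; simpa using hg.measure_eq_zero hU
  filter_upwards [this] with x hx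
  simp [hs x hx]

lemma divergence_smul_const {φ : Eu n → ℝ} (hφ : ContDiff ℝ 1 φ) (x v t : Eu n) :
    divergence (fun t => φ (x - t) • v) t = - (fderiv ℝ φ (x - t) v) := by
  have h1 : HasFDerivAt (fun t => φ (x - t)) (-(fderiv ℝ φ (x - t))) t := by
    have := ((hφ.differentiable one_ne_zero) (x - t)).hasFDerivAt.comp t
      ((hasFDerivAt_id t).const_sub x)
    refine this.congr_fderiv ?_
    ext; simp
  have h2 := h1.smul_const v
  unfold divergence
  rw [h2.fderiv]
  have : ((ContinuousLinearMap.smulRight (-(fderiv ℝ φ (x - t))) v : Eu n →L[ℝ] Eu n)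
      : Eu n →ₗ[ℝ] Eu n) =
      LinearMap.smulRight ((-(fderiv ℝ φ (x - t)) : Eu n →L[ℝ] ℝ) : Eu n →ₗ[ℝ] ℝ) v := rfl
  rw [this, LinearMap.trace_smulRight]
  simp

/-- The derivative of the mollified indicator at x in direction v is minus the integral over E of
the divergence of t ↦ φ(x - t) v. This field is supported in the ball of radius `φ.rOut` about x,
hence in U, where the Gauss-Green measure vanishes. -/
lemma HasFinitePerimeter.hasFDerivAt_convolution {E U : Set (Eu n)} (h : HasFinitePerimeter E)
    (hU : Disjoint U (reducedBoundary E)) (φ : ContDiffBump (0 : Eu n)) {x : Eu n}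
    (hx : ball x φ.rOut ⊆ U) :
    HasFDerivAt (MeasureTheory.convolution (φ.normed volume) (E.indicator fun _ => (1 : ℝ))
      (ContinuousLinearMap.lsmul ℝ ℝ) volume) (0 : Eu n →L[ℝ] ℝ) x := by
  have hE : NullMeasurableSet E volume := h.1
  have hφ : ContDiff ℝ 1 (φ.normed volume) := φ.contDiff_normed
  have hcφ : HasCompactSupport (φ.normed volume) := φ.hasCompactSupport_normed
  have hg : LocallyIntegrable (E.indicator fun _ => (1 : ℝ)) (volume : Measure (Eu n)) := by
    refine (locallyIntegrable_const (1 : ℝ)).mono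
      ((aestronglyMeasurable_const).indicator₀ hE) ?_
    filter_upwards with y
    by_cases hy : y ∈ E <;> simp [hy]
  have key := hcφ.hasFDerivAt_convolution_left (ContinuousLinearMap.lsmul ℝ ℝ) hφ hg x
  refine key.congr_fderiv ?_
  ext v
  have hex := (hcφ.fderiv ℝ).convolutionExists_left
    ((ContinuousLinearMap.lsmul ℝ ℝ).precompL (Eu n))
    (hφ.continuous_fderiv one_ne_zero) hg x
  rw [convolution_eq_swap, ContinuousLinearMap.integral_apply hex.integrable_swap]
  have hT := h.integral_divergence_eq_zero hU
    (T := fun t => φ.normed volume (x - t) • v) (by fun_prop)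
    (by
      have : HasCompactSupport (fun t => φ.normed volume (x - t)) :=
        hcφ.comp_homeomorph (Homeomorph.subLeft x)
      exact this.smul_right)
    (by
      intro t ht
      have : φ.normed volume (x - t) = 0 := by
        rw [← Function.notMem_support, φ.support_normed_eq]
        intro h'
        apply ht
        apply hx
        rw [mem_ball, dist_comm, dist_eq_norm]
        simpa using h'
      simp [this])
  rw [← integral_indicator₀ hE] at hT
  rw [zero_apply, ← neg_eq_zero, ← integral_neg, ← hT]
  congr 1
  ext t
  by_cases ht : t ∈ E
  · simp [ht, divergence_smul_const hφ, ContinuousLinearMap.precompL]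
  · simp [ht, ContinuousLinearMap.precompL]

/-- A set of finite perimeter whose reduced boundary misses an open convex set is null or of full
measure there. -/
theorem HasFinitePerimeter.null_or_full {E U : Set (Eu n)} (h : HasFinitePerimeter E)
    (hU : Disjoint U (reducedBoundary E)) (hUo : IsOpen U) (hUc : Convex ℝ U) :
    volume (E ∩ U) = 0 ∨ volume (U \ E) = 0 := by
  have hE : NullMeasurableSet E volume := h.1
  have hg : LocallyIntegrable (E.indicator fun _ => (1 : ℝ)) (volume : Measure (Eu n)) := by
    refine (locallyIntegrable_const (1 : ℝ)).mono
      ((aestronglyMeasurable_const).indicator₀ hE) ?_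
    filter_upwards with y
    by_cases hy : y ∈ E <;> simp [hy]
  let φ : ℕ → ContDiffBump (0 : Eu n) := fun k =>
    ⟨1 / ((k : ℝ) + 1), 2 * (1 / ((k : ℝ) + 1)), by positivity, by
      have : 0 < 1 / ((k : ℝ) + 1) := by positivity
      linarith⟩
  have hφ0 : Tendsto (fun k => (φ k).rOut) atTop (𝓝 0) := by
    have := (tendsto_one_div_add_atTop_nhds_zero_nat (𝕜 := ℝ)).const_mul 2
    simpa [φ] using this
  have hlim := ContDiffBump.ae_convolution_tendsto_right_of_locallyIntegrable (K := 2) hφ0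
    (Eventually.of_forall fun k => le_rfl) hg
  set u : ℕ → Eu n → ℝ := fun k => MeasureTheory.convolution ((φ k).normed volume)
    (E.indicator fun _ => (1 : ℝ)) (ContinuousLinearMap.lsmul ℝ ℝ) volume with hu
  have hconst : ∀ x ∈ U, ∀ y ∈ U, ∀ᶠ k in atTop, u k x = u k y := by
    intro x hx y hy
    obtain ⟨r, hr, hrx⟩ := Metric.isOpen_iff.1 hUo x hx
    obtain ⟨s, hs, hsy⟩ := Metric.isOpen_iff.1 hUo y hy
    filter_upwards [hφ0.eventually (gt_mem_nhds (lt_min hr hs))] with k hk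
    have hk' := lt_min_iff.1 hk
    -- By convexity the tube of radius `rOut` about the segment lies in U: a point a x + b y + d is
    -- the combination of x + d and y + d with weights a and b.
    have hsub : ∀ z ∈ segment ℝ x y, ball z (φ k).rOut ⊆ U := by
      rintro z ⟨a, b, ha, hb, hab, rfl⟩ p hp
      have e : p = a • (x + (p - (a • x + b • y))) + b • (y + (p - (a • x + b • y))) := by
        have : p = (a • x + b • y) + (a + b) • (p - (a • x + b • y)) := by rw [hab]; simp
        rw [add_smul] at this
        rw [smul_add, smul_add]
        calc p = _ := this
          _ = _ := by abel
      rw [e]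
      rw [mem_ball, dist_eq_norm] at hp
      refine hUc (hrx ?_) (hsy ?_) ha hb hab
      · rw [mem_ball, dist_eq_norm, add_sub_cancel_left]; linarith
      · rw [mem_ball, dist_eq_norm, add_sub_cancel_left]; linarith
    have hd : ∀ z ∈ segment ℝ x y, HasFDerivWithinAt (u k) (0 : Eu n →L[ℝ] ℝ) (segment ℝ x y) z :=
      fun z hz => (h.hasFDerivAt_convolution hU (φ k) (hsub z hz)).hasFDerivWithinAt
    have := (convex_segment x y).norm_image_sub_le_of_norm_hasFDerivWithin_le (C := 0) hd
      (fun z _ => by simp) (right_mem_segment ℝ x y) (left_mem_segment ℝ x y)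
    rw [zero_mul] at this
    exact sub_eq_zero.1 (norm_le_zero_iff.1 this)
  -- Almost everywhere the mollifications converge to the indicator of E. Since their values at any
  -- two points of U eventually agree, one good point of E in U forces the limit 1 throughout U.
  by_cases hex : ∃ x ∈ U, x ∈ E ∧ Tendsto (fun k => u k x) atTop (𝓝 1)
  · right
    obtain ⟨x, hxU, _, hx⟩ := hex
    refine measure_mono_null ?_ (ae_iff.1 hlim)
    rintro y ⟨hyU, hyE⟩ hy
    have h1 : Tendsto (fun k => u k y) atTop (𝓝 1) := hx.congr' (hconst x hxU y hyU)
    have := tendsto_nhds_unique h1 hy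
    simp [hyE] at this
  · left
    refine measure_mono_null ?_ (ae_iff.1 hlim)
    rintro y ⟨hyE, hyU⟩ hy
    refine hex ⟨y, hyU, hyE, ?_⟩
    simpa [hyE] using hy

end Perimeter

section Polytope

variable {n : ℕ}

/-! ### Facets and spanning sets -/

lemma vectorSpan_le_orthogonal {F : Set (Eu n)} {u : Eu n} {c : ℝ}
    (hF : ∀ x ∈ F, inner ℝ x u = c) : vectorSpan ℝ F ≤ (Submodule.span ℝ {u})ᗮ := by
  rw [vectorSpan, Submodule.span_le]
  rintro _ ⟨x, hx, y, hy, rfl⟩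
  rw [SetLike.mem_coe, Submodule.mem_orthogonal_singleton_iff_inner_left]
  simp [inner_sub_left, hF x hx, hF y hy]

/-- A subset of an affine hyperplane that misses the origin has dimension `n - 1` if and only if
it spans the whole space. -/
lemma facetDim_iff_span (hn : 2 ≤ n) {F : Set (Eu n)} {u : Eu n} {c : ℝ} (hc : c ≠ 0)
    (hF : ∀ x ∈ F, inner ℝ x u = c) : FacetDim F ↔ Submodule.span ℝ F = ⊤ := by
  have hrank : Module.finrank ℝ (Eu n) = n := by simp
  rcases F.eq_empty_or_nonempty with rfl | ⟨v, hv⟩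
  · have h0 : Module.finrank ℝ (vectorSpan ℝ (∅ : Set (Eu n))) = 0 := by
      rw [vectorSpan_empty, finrank_bot]
    rw [FacetDim, h0, Submodule.span_empty]
    constructor
    · intro h; omega
    · intro h
      have := finrank_bot ℝ (Eu n)
      rw [h, finrank_top, hrank] at this
      omega
  have hle := vectorSpan_le_orthogonal hF
  have hsub : vectorSpan ℝ F ≤ Submodule.span ℝ F := by
    rw [vectorSpan, Submodule.span_le]
    rintro _ ⟨x, hx, y, hy, rfl⟩
    exact Submodule.sub_mem _ (Submodule.subset_span hx) (Submodule.subset_span hy)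
  have hvW : v ∉ vectorSpan ℝ F := fun h => by
    have := Submodule.mem_orthogonal_singleton_iff_inner_left.1 (hle h)
    exact hc ((hF v hv).symm.trans this)
  have hlt : vectorSpan ℝ F < Submodule.span ℝ F :=
    lt_of_le_of_ne hsub fun h => hvW (h ▸ Submodule.subset_span hv)
  have hsup : Submodule.span ℝ F ≤ vectorSpan ℝ F ⊔ Submodule.span ℝ {v} := by
    rw [Submodule.span_le]
    intro x hx
    have : x = (x - v) + v := by simp
    rw [this]
    exact Submodule.add_mem_sup (vsub_mem_vectorSpan ℝ hx hv) (Submodule.mem_span_singleton_self v)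
  have h1 := Submodule.finrank_lt_finrank_of_lt hlt
  have h2 := Submodule.finrank_mono hsup
  have h3 := Submodule.finrank_add_le_finrank_add_finrank (vectorSpan ℝ F) (Submodule.span ℝ {v})
  have h4 := finrank_span_le_card (R := ℝ) ({v} : Set (Eu n))
  have h5 : Module.finrank ℝ (Submodule.span ℝ F) ≤ Module.finrank ℝ (Eu n) :=
    Submodule.finrank_le _
  simp only [toFinset_singleton, Finset.card_singleton] at h4
  constructor
  · intro h
    apply Submodule.eq_top_of_finrank_eq
    rw [FacetDim] at h
    omega
  · intro h
    rw [h, finrank_top] at h1 h2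
    rw [FacetDim]
    omega

/-! ### Polyhedra given by half-spaces -/

variable {ι : Type*}

/-- The open polyhedron with outer normals `w i` and support numbers `h i`. -/
def hpoly (w : ι → Eu n) (h : ι → ℝ) : Set (Eu n) := {x | ∀ i, inner ℝ x (w i) < h i}

/-- The cone over the facet of `hpoly w h` with normal `w i`. -/
def sector (w : ι → Eu n) (h : ι → ℝ) (i : ι) : Set (Eu n) :=
  {x | ∀ j, h i * inner ℝ x (w j) ≤ h j * inner ℝ x (w i)}

/-- The `i`-th inequality of `hpoly w h` is tight at a point where the others are strict. -/
def HasSlack (w : ι → Eu n) (h : ι → ℝ) (i : ι) : Prop :=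
  ∃ p, inner ℝ p (w i) = h i ∧ ∀ j, j ≠ i → inner ℝ p (w j) < h j

lemma isOpen_hpoly [Finite ι] (w : ι → Eu n) (h : ι → ℝ) : IsOpen (hpoly w h) := by
  simp only [hpoly, ofPred_forall]
  exact isOpen_iInter_of_finite fun i => isOpen_lt (by fun_prop) continuous_const

lemma convex_hpoly (w : ι → Eu n) (h : ι → ℝ) : Convex ℝ (hpoly w h) := by
  intro x hx y hy a b ha hb hab i
  rw [inner_add_left, real_inner_smul_left, real_inner_smul_left]
  have h1 := hx i
  have h2 := hy i
  rcases ha.eq_or_lt with rfl | ha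
  · simp only [zero_add] at hab; subst hab; linarith
  · have e : h i = a * h i + b * h i := by rw [← add_mul, hab, one_mul]
    nlinarith [mul_lt_mul_of_pos_left h1 ha, mul_le_mul_of_nonneg_left h2.le hb]

lemma face_hpoly [Finite ι] (w : ι → Eu n) {h : ι → ℝ} (hh : ∀ i, 0 < h i) (i : ι) :
    frontier (hpoly w h) ∩ {x | inner ℝ x (w i) = h i} =
      {x | inner ℝ x (w i) = h i ∧ ∀ j, inner ℝ x (w j) ≤ h j} := by
  ext x
  rw [(isOpen_hpoly w h).frontier_eq]
  constructor
  · rintro ⟨⟨hx, _⟩, hxi⟩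
    refine ⟨hxi, fun j => ?_⟩
    have hcl : IsClosed {x : Eu n | inner ℝ x (w j) ≤ h j} :=
      isClosed_le (by fun_prop) continuous_const
    exact closure_minimal (fun y (hy : y ∈ hpoly w h) => (hy j).le) hcl hx
  · rintro ⟨hxi, hx⟩
    refine ⟨⟨?_, fun h' => (h' i).ne hxi⟩, hxi⟩
    have ht : Tendsto (fun t : ℝ => t • x) (𝓝[<] 1) (𝓝 x) := by
      have : Tendsto (fun t : ℝ => t • x) (𝓝 1) (𝓝 ((1 : ℝ) • x)) :=
        (continuous_id.smul continuous_const).tendsto 1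
      rw [one_smul] at this
      exact this.mono_left nhdsWithin_le_nhds
    refine mem_closure_of_tendsto ht ?_
    filter_upwards [Ioo_mem_nhdsLT (zero_lt_one' ℝ)] with t ht j
    rw [real_inner_smul_left]
    have := hx j
    have := hh j
    nlinarith [ht.1, ht.2]

/-- For each j ≠ i some point of the face has j-th inequality strict: otherwise h i • w j and h j •
w i would agree on the face, hence everywhere as it spans, and w j would be a positive multiple of w
i. The average of these points has all of these inequalities strict. -/
lemma hasSlack_of_span [Finite ι] {w : ι → Eu n} {h : ι → ℝ} (hh : ∀ i, 0 < h i)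
    (hw : ∀ i j, i ≠ j → ∀ c : ℝ, 0 < c → w j ≠ c • w i) {i : ι} (hwi : w i ≠ 0)
    (hs : Submodule.span ℝ {x | inner ℝ x (w i) = h i ∧ ∀ j, inner ℝ x (w j) ≤ h j} = ⊤) :
    HasSlack w h i := by
  classical
  have := Fintype.ofFinite ι
  set F := {x | inner ℝ x (w i) = h i ∧ ∀ j, inner ℝ x (w j) ≤ h j} with hF
  have hex : ∀ j, j ≠ i → ∃ p ∈ F, inner ℝ p (w j) < h j := by
    intro j hj
    by_contra! hcon
    have heq : ∀ p ∈ F, inner ℝ p (w j) = h j := fun p hp => le_antisymm (hp.2 j) (hcon p hp)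
    have hzero : ∀ x : Eu n, inner ℝ x (h i • w j - h j • w i) = 0 := by
      intro x
      have hx : x ∈ Submodule.span ℝ F := hs ▸ Submodule.mem_top
      induction hx using Submodule.span_induction with
      | mem x hx =>
        rw [inner_sub_right, real_inner_smul_right, real_inner_smul_right, heq x hx, hx.1]; ring
      | zero => simp
      | add x y _ _ hx hy => rw [inner_add_left, hx, hy, add_zero]
      | smul c x _ hx => rw [real_inner_smul_left, hx, mul_zero]
    have h0 : h i • w j - h j • w i = 0 := inner_self_eq_zero.1 (hzero _)
    refine hw i j hj.symm (h j / h i) (div_pos (hh j) (hh i)) ?_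
    rw [div_eq_inv_mul, mul_smul, ← sub_eq_zero.1 h0, smul_smul, inv_mul_cancel₀ (hh i).ne',
      one_smul]
  have hne : F.Nonempty := by
    by_contra hemp
    rw [not_nonempty_iff_eq_empty] at hemp
    rw [hemp, Submodule.span_empty] at hs
    have : w i ∈ (⊥ : Submodule ℝ (Eu n)) := hs ▸ Submodule.mem_top
    exact hwi (by simpa using this)
  obtain ⟨p₀, hp₀⟩ := hne
  choose! p hpF hp using hex
  -- The entry at i is only a filler, so that the average runs over all of ι.
  let q : ι → Eu n := fun j => if j = i then p₀ else p j
  have hq : ∀ j, q j ∈ F := fun j => by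
    by_cases hj : j = i
    · simp [q, hj, hp₀]
    · simpa [q, hj] using hpF j hj
  have hN : (0 : ℝ) < Fintype.card ι := by
    have : Nonempty ι := ⟨i⟩
    exact_mod_cast Fintype.card_pos
  refine ⟨(Fintype.card ι : ℝ)⁻¹ • ∑ j, q j, ?_, fun k hk => ?_⟩
  · rw [real_inner_smul_left, sum_inner, Finset.sum_congr rfl fun j _ => (hq j).1]
    simp [hN.ne']
  · rw [real_inner_smul_left, sum_inner, inv_mul_lt_iff₀ hN]
    have : ∑ j, inner ℝ (q j) (w k) < ∑ _j : ι, h k :=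
      Finset.sum_lt_sum (fun j _ => (hq j).2 k) ⟨k, Finset.mem_univ _, by
        simpa [q, hk] using hp k hk⟩
    simpa using this

/-- A slack point can be moved a little in every direction orthogonal to w i without leaving the
face; the point itself supplies the remaining direction. -/
lemma span_of_hasSlack [Finite ι] {w : ι → Eu n} {h : ι → ℝ} {i : ι} (hi : 0 < h i)
    (hs : HasSlack w h i) :
    Submodule.span ℝ {x | inner ℝ x (w i) = h i ∧ ∀ j, inner ℝ x (w j) ≤ h j} = ⊤ := by
  obtain ⟨p, hp, hpj⟩ := hs
  set F := {x | inner ℝ x (w i) = h i ∧ ∀ j, inner ℝ x (w j) ≤ h j} with hF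
  have hpF : p ∈ F := ⟨hp, fun j => by
    by_cases hj : j = i
    · rw [hj, hp]
    · exact (hpj j hj).le⟩
  have hz : ∀ z : Eu n, inner ℝ z (w i) = 0 → z ∈ Submodule.span ℝ F := by
    intro z hz
    have hev : ∀ᶠ t : ℝ in 𝓝[>] 0, ∀ j, j ≠ i → inner ℝ (p + t • z) (w j) < h j := by
      refine nhdsWithin_le_nhds ?_
      refine eventually_all.2 fun j => ?_
      by_cases hj : j = i
      · simp [hj]
      have hc : Continuous fun t : ℝ => inner ℝ (p + t • z) (w j) := by fun_prop
      have := hc.tendsto 0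
      simp only [zero_smul, add_zero] at this
      exact (this.eventually (gt_mem_nhds (hpj j hj))).mono fun t ht _ => ht
    obtain ⟨t, ht, ht0⟩ := (hev.and self_mem_nhdsWithin).exists
    have ht0 : 0 < t := ht0
    have hmem : p + t • z ∈ F := by
      have h1 : inner ℝ (p + t • z) (w i) = h i := by
        rw [inner_add_left, real_inner_smul_left, hz, hp]; ring
      refine ⟨h1, fun j => ?_⟩
      by_cases hj : j = i
      · rw [hj, h1]
      · exact (ht j hj).le
    have : z = t⁻¹ • ((p + t • z) - p) := by
      rw [add_sub_cancel_left, smul_smul, inv_mul_cancel₀ ht0.ne', one_smul]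
    rw [this]
    exact Submodule.smul_mem _ _ (Submodule.sub_mem _ (Submodule.subset_span hmem)
      (Submodule.subset_span hpF))
  rw [eq_top_iff]
  intro x _
  have : x = (inner ℝ x (w i) / h i) • p + (x - (inner ℝ x (w i) / h i) • p) := by simp
  rw [this]
  refine Submodule.add_mem _ (Submodule.smul_mem _ _ (Submodule.subset_span hpF)) (hz _ ?_)
  rw [inner_sub_left, real_inner_smul_left, hp]
  field_simp
  ring

/-- A nonzero z in the sector has ⟨z, w i⟩ > 0, because some ⟨z, w k⟩ is positive. Rescaled to ⟨z, w
i⟩ = h i, the sector inequalities become those of the face. -/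
lemma coneOver_eq_sector {w : ι → Eu n} {h : ι → ℝ} (hh : ∀ i, 0 < h i)
    (hb : ∀ x : Eu n, x ≠ 0 → ∃ i, 0 < inner ℝ x (w i)) {i : ι} (hs : HasSlack w h i) :
    coneOver {x | inner ℝ x (w i) = h i ∧ ∀ j, inner ℝ x (w j) ≤ h j} = sector w h i := by
  obtain ⟨p, hp, hpj⟩ := hs
  have hpF : ∀ j, inner ℝ p (w j) ≤ h j := fun j => by
    by_cases hj : j = i
    · rw [hj, hp]
    · exact (hpj j hj).le
  ext z
  constructor
  · rintro ⟨t, ht, x, ⟨hx, hxj⟩, rfl⟩ j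
    rw [real_inner_smul_left, real_inner_smul_left, hx]
    have := mul_le_mul_of_nonneg_left (hxj j) (mul_nonneg ht (hh i).le)
    linarith
  · intro hz
    by_cases h0 : z = 0
    · exact ⟨0, le_rfl, p, ⟨hp, hpF⟩, by simp [h0]⟩
    obtain ⟨k, hk⟩ := hb z h0
    have hpos : 0 < inner ℝ z (w i) := by
      have h1 := hz k
      have h2 := mul_pos (hh i) hk
      exact pos_of_mul_pos_right (h2.trans_le h1) (hh k).le
    refine ⟨inner ℝ z (w i) / h i, (div_pos hpos (hh i)).le, (h i / inner ℝ z (w i)) • z,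
      ⟨?_, fun j => ?_⟩, ?_⟩
    · rw [real_inner_smul_left]; field_simp
    · rw [real_inner_smul_left, div_mul_eq_mul_div, div_le_iff₀ hpos]
      exact hz j
    · rw [smul_smul]
      have := (hh i).ne'
      field_simp
      simp

end Polytope

section Wulff

variable {n : ℕ} {f : Eu n → ℝ}

/-! ### Crystalline integrands -/

/-- `V` represents `f` as a maximum of linear functions. -/
def Represents (V : Finset (Eu n)) (f : Eu n → ℝ) : Prop :=
  ∀ x, IsGreatest ((fun v => inner ℝ v x) '' (V : Set (Eu n))) (f x)

/-- The elements of `V` at which the maximum defining `f ν` is attained. -/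
def contact (V : Finset (Eu n)) (f : Eu n → ℝ) (ν : Eu n) : Set (Eu n) :=
  {v | v ∈ V ∧ inner ℝ v ν = f ν}

namespace Represents

variable {V : Finset (Eu n)} (hV : Represents V f)

include hV

lemma inner_le {v : Eu n} (hv : v ∈ V) (x : Eu n) : inner ℝ v x ≤ f x :=
  (hV x).2 ⟨v, hv, rfl⟩

lemma exists_eq (x : Eu n) : ∃ v ∈ V, inner ℝ v x = f x := (hV x).1

lemma smul {c : ℝ} (hc : 0 ≤ c) (x : Eu n) : f (c • x) = c * f x := by
  obtain ⟨v, hv, h⟩ := hV.exists_eq x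
  obtain ⟨u, hu, h'⟩ := hV.exists_eq (c • x)
  apply le_antisymm
  · rw [← h', real_inner_smul_right]
    exact mul_le_mul_of_nonneg_left (hV.inner_le hu x) hc
  · rw [← h, ← real_inner_smul_right]
    exact hV.inner_le hv _

lemma continuous : Continuous f := by
  have hne : V.Nonempty := let ⟨v, hv, _⟩ := hV.exists_eq 0; ⟨v, hv⟩
  have : f = fun x => V.sup' hne fun v => inner ℝ v x := by
    ext x
    apply le_antisymm
    · obtain ⟨v, hv, h⟩ := hV.exists_eq x
      rw [← h]
      exact Finset.le_sup' (fun v => inner ℝ v x) hv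
    · exact Finset.sup'_le _ _ fun v hv => hV.inner_le hv x
  rw [this]
  exact Continuous.finset_sup'_apply hne fun v _ => by fun_prop

/-- A separating functional ⟨·, μ⟩ would exceed at y its maximum over V, which is f μ. -/
lemma mem_convexHull {y : Eu n} (hy : ∀ μ, inner ℝ y μ ≤ f μ) :
    y ∈ convexHull ℝ (V : Set (Eu n)) := by
  by_contra hcon
  obtain ⟨g, u, hg, hu⟩ := geometric_hahn_banach_closed_point (convex_convexHull ℝ _)
    (V.finite_toSet.isClosed_convexHull ℝ) hcon
  set μ := (InnerProductSpace.toDual ℝ (Eu n)).symm g with hμ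
  have hgμ : ∀ x, g x = inner ℝ x μ := fun x => by
    rw [real_inner_comm, hμ, InnerProductSpace.toDual_symm_apply]
  obtain ⟨v, hv, h⟩ := hV.exists_eq μ
  have h1 := hg v (subset_convexHull ℝ _ hv)
  have h2 := hy μ
  rw [hgμ] at h1 hu
  linarith

/-- In a convex combination of V that maximises ⟨·, ν⟩, only maximisers carry weight. -/
lemma mem_span_contact {y ν : Eu n} (hy : ∀ μ, inner ℝ y μ ≤ f μ) (hν : inner ℝ y ν = f ν) :
    y ∈ Submodule.span ℝ (contact V f ν) := by
  obtain ⟨c, hc0, hc1, hcy⟩ := Finset.mem_convexHull.1 (hV.mem_convexHull hy)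
  rw [Finset.centerMass_eq_of_sum_1 _ _ hc1] at hcy
  have hsum : ∑ v ∈ V, c v * (f ν - inner ℝ v ν) = 0 := by
    have : ∑ v ∈ V, c v * inner ℝ v ν = f ν := by
      rw [← hν, ← hcy, sum_inner]
      exact Finset.sum_congr rfl fun v _ => by rw [real_inner_smul_left]; rfl
    simp_rw [mul_sub]
    rw [Finset.sum_sub_distrib, this, ← Finset.sum_mul, hc1]; ring
  have hz := (Finset.sum_eq_zero_iff_of_nonneg fun v hv =>
    mul_nonneg (hc0 v hv) (sub_nonneg.2 (hV.inner_le hv ν))).1 hsum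
  rw [← hcy]
  refine Submodule.sum_mem _ fun v hv => ?_
  rcases mul_eq_zero.1 (hz v hv) with h | h
  · rw [h, zero_smul]; exact Submodule.zero_mem _
  · exact Submodule.smul_mem _ _ (Submodule.subset_span ⟨hv, (sub_eq_zero.1 h).symm⟩)

end Represents

lemma inner_le_of_mem_closure_wulff {V : Finset (Eu n)} (hV : Represents V f) {x : Eu n}
    (hx : x ∈ closure (wulff f)) (μ : Eu n) : inner ℝ x μ ≤ f μ := by
  by_cases h0 : μ = 0
  · have := hV.smul le_rfl (0 : Eu n)
    simp only [smul_zero, zero_mul] at this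
    simp [h0, this]
  have hpos : 0 < ‖μ‖ := norm_pos_iff.2 h0
  have hcl : IsClosed {x : Eu n | inner ℝ x (‖μ‖⁻¹ • μ) ≤ f (‖μ‖⁻¹ • μ)} :=
    isClosed_le (by fun_prop) continuous_const
  have h1 : inner ℝ x (‖μ‖⁻¹ • μ) ≤ f (‖μ‖⁻¹ • μ) :=
    closure_minimal (fun y (hy : y ∈ wulff f) => (hy _ (by
      rw [norm_smul, norm_inv, norm_norm, inv_mul_cancel₀ hpos.ne'])).le) hcl hx
  rw [hV.smul (by positivity), real_inner_smul_right] at h1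
  exact le_of_mul_le_mul_left h1 (by positivity)

section Positive

variable {V : Finset (Eu n)} (hV : Represents V f) (hpos : ∀ x, x ≠ 0 → 0 < f x)

include hV hpos

lemma contact_subset_face {ν : Eu n} (hν : ‖ν‖ = 1) :
    contact V f ν ⊆ face (wulff f) ν (f ν) := by
  rintro v ⟨hv, hvν⟩
  refine ⟨⟨?_, fun h => ((interior_subset h) ν hν).ne hvν⟩, hvν⟩
  have ht : Tendsto (fun t : ℝ => t • v) (𝓝[<] 1) (𝓝 v) := by
    have : Tendsto (fun t : ℝ => t • v) (𝓝 1) (𝓝 ((1 : ℝ) • v)) :=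
      (continuous_id.smul continuous_const).tendsto 1
    rw [one_smul] at this
    exact this.mono_left nhdsWithin_le_nhds
  refine mem_closure_of_tendsto ht ?_
  filter_upwards [Ioo_mem_nhdsLT (zero_lt_one' ℝ)] with t ht μ hμ
  rw [real_inner_smul_left]
  have h1 := hV.inner_le hv μ
  have h2 := hpos μ (norm_ne_zero_iff.1 (by rw [hμ]; exact one_ne_zero))
  nlinarith [ht.1, ht.2]

lemma mem_facetNormals_iff (hn : 2 ≤ n) {ν : Eu n} :
    ν ∈ facetNormals f ↔ ‖ν‖ = 1 ∧ Submodule.span ℝ (contact V f ν) = ⊤ := by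
  refine and_congr_right fun hν => ?_
  have hf := hpos ν (norm_ne_zero_iff.1 (by rw [hν]; exact one_ne_zero))
  rw [facetDim_iff_span hn hf.ne' (fun x hx => hx.2)]
  constructor
  · intro h
    rw [eq_top_iff, ← h, Submodule.span_le]
    exact fun x hx => hV.mem_span_contact
      (inner_le_of_mem_closure_wulff hV hx.1.1) hx.2
  · intro h
    rw [eq_top_iff, ← h]
    exact Submodule.span_mono (contact_subset_face hV hpos hν)

/-- The contact set determines a facet normal: if ν and μ share a spanning contact set, then f(μ) ν
= f(ν) μ, and both are unit vectors. There are only finitely many subsets of V. -/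
lemma finite_facetNormals (hn : 2 ≤ n) : (facetNormals f).Finite := by
  refine Set.Finite.of_finite_image (f := contact V f)
    ((V.finite_toSet.finite_subsets).subset ?_) ?_
  · rintro _ ⟨ν, _, rfl⟩
    exact fun v hv => hv.1
  · intro ν hν μ hμ heq
    have heq : contact V f ν = contact V f μ := heq
    obtain ⟨h1, h2⟩ := (mem_facetNormals_iff hV hpos hn).1 hν
    obtain ⟨h3, h4⟩ := (mem_facetNormals_iff hV hpos hn).1 hμ
    have hf := hpos ν (norm_ne_zero_iff.1 (by rw [h1]; exact one_ne_zero))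
    have hf' := hpos μ (norm_ne_zero_iff.1 (by rw [h3]; exact one_ne_zero))
    have hzero : ∀ x : Eu n, inner ℝ x (f μ • ν - f ν • μ) = 0 := by
      intro x
      have hx : x ∈ Submodule.span ℝ (contact V f ν) := h2 ▸ Submodule.mem_top
      induction hx using Submodule.span_induction with
      | mem x hx =>
        have hx' : x ∈ contact V f μ := heq ▸ hx
        rw [inner_sub_right, real_inner_smul_right, real_inner_smul_right, hx.2, hx'.2]; ring
      | zero => simp
      | add x y _ _ hx hy => rw [inner_add_left, hx, hy, add_zero]
      | smul c x _ hx => rw [real_inner_smul_left, hx, mul_zero]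
    have h0 := sub_eq_zero.1 (inner_self_eq_zero.1 (hzero _) : f μ • ν - f ν • μ = 0)
    have hn1 := congrArg norm h0
    rw [norm_smul, norm_smul, h1, h3, mul_one, mul_one, Real.norm_of_nonneg hf.le,
      Real.norm_of_nonneg hf'.le] at hn1
    rw [hn1] at h0
    exact smul_right_injective _ hf.ne' h0

/-- Take ν maximising ⟨x, ν⟩ / f ν on the sphere. The maximum g is the gauge of x, so that x / g
lies on the supporting hyperplane of K with normal ν. -/
lemma exists_support {x : Eu n} (hx : x ≠ 0) :
    ∃ (ν : Eu n) (g : ℝ), ‖ν‖ = 1 ∧ 0 < g ∧ inner ℝ x ν = g * f ν ∧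
      ∀ μ, inner ℝ x μ ≤ g * f μ := by
  have hne0 : ∀ μ : Eu n, μ ∈ sphere (0 : Eu n) 1 → 0 < f μ := fun μ hμ =>
    hpos μ (norm_ne_zero_iff.1 (by rw [mem_sphere_zero_iff_norm.1 hμ]; exact one_ne_zero))
  have hunit : ‖x‖⁻¹ • x ∈ sphere (0 : Eu n) 1 := by
    rw [mem_sphere_zero_iff_norm, norm_smul, norm_inv, norm_norm,
      inv_mul_cancel₀ (norm_ne_zero_iff.2 hx)]
  obtain ⟨ν, hν, hmax⟩ := (isCompact_sphere (0 : Eu n) 1).exists_isMaxOn ⟨_, hunit⟩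
    (f := fun ν => inner ℝ x ν / f ν)
    (ContinuousOn.div (by fun_prop) hV.continuous.continuousOn fun μ hμ => (hne0 μ hμ).ne')
  have hfν := hne0 ν hν
  refine ⟨ν, inner ℝ x ν / f ν, mem_sphere_zero_iff_norm.1 hν, ?_, by field_simp, fun μ => ?_⟩
  · refine lt_of_lt_of_le ?_ (hmax hunit)
    refine div_pos ?_ (hne0 _ hunit)
    rw [real_inner_smul_right, real_inner_self_eq_norm_sq]
    have := norm_pos_iff.2 hx
    positivity
  · by_cases h0 : μ = 0
    · have := hV.smul le_rfl (0 : Eu n)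
      simp only [smul_zero, zero_mul] at this
      simp [h0, this]
    have hμ : 0 < ‖μ‖ := norm_pos_iff.2 h0
    have hu : ‖μ‖⁻¹ • μ ∈ sphere (0 : Eu n) 1 := by
      rw [mem_sphere_zero_iff_norm, norm_smul, norm_inv, norm_norm, inv_mul_cancel₀ hμ.ne']
    have h1 := (div_le_iff₀ (hne0 _ hu)).1 (hmax hu)
    rw [hV.smul (by positivity), real_inner_smul_right] at h1
    refine le_of_mul_le_mul_left ?_ (inv_pos.2 hμ)
    linarith

/-- A crystal is the intersection of the half-spaces of its facets. -/
lemma mem_wulff_of_facets (hn : 2 ≤ n) {x : Eu n}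
    (hx : ∀ ν ∈ facetNormals f, inner ℝ x ν < f ν) : x ∈ wulff f := by
  have hfin := finite_facetNormals hV hpos hn
  intro ν₀ hν₀
  by_contra! hcon
  have hf₀ := hpos ν₀ (norm_ne_zero_iff.1 (by rw [hν₀]; exact one_ne_zero))
  have hO1 : IsOpen {y : Eu n | ∀ ν ∈ facetNormals f, inner ℝ y ν < f ν} := by
    have : {y : Eu n | ∀ ν ∈ facetNormals f, inner ℝ y ν < f ν} =
        ⋂ ν ∈ facetNormals f, {y | inner ℝ y ν < f ν} := by ext; simp
    rw [this]
    exact hfin.isOpen_biInter fun ν _ => isOpen_lt (by fun_prop) continuous_const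
  have hO2 : IsOpen {y : Eu n | f ν₀ < inner ℝ y ν₀} := isOpen_lt continuous_const (by fun_prop)
  have hO := hO1.inter hO2
  have hne : ({y : Eu n | ∀ ν ∈ facetNormals f, inner ℝ y ν < f ν} ∩
      {y : Eu n | f ν₀ < inner ℝ y ν₀}).Nonempty := by
    -- A slight dilation makes the violated inequality strict, so the set of counterexamples
    -- contains a nonempty open set.
    have ht : Tendsto (fun t : ℝ => t • x) (𝓝[>] 1) (𝓝 x) := by
      have : Tendsto (fun t : ℝ => t • x) (𝓝 1) (𝓝 ((1 : ℝ) • x)) :=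
        (continuous_id.smul continuous_const).tendsto 1
      rw [one_smul] at this
      exact this.mono_left nhdsWithin_le_nhds
    obtain ⟨t, ht1, ht2⟩ := ((ht.eventually (hO1.mem_nhds hx)).and self_mem_nhdsWithin).exists
    refine ⟨t • x, ht1, ?_⟩
    change f ν₀ < inner ℝ (t • x) ν₀
    rw [real_inner_smul_left]
    have ht2 : 1 < t := ht2
    nlinarith
  -- Choose a counterexample y outside the finitely many proper subspaces spanned by subsets of V.
  -- The ray through y then leaves K at a point whose contact set spans, that is, through a facet.
  -- The inequality of that facet gives g < 1, while y violating the inequality of ν₀ gives g > 1.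
  set B : Set (Eu n) := ⋃ S ∈ {S : Set (Eu n) | S ⊆ V ∧ Submodule.span ℝ S ≠ ⊤},
    (Submodule.span ℝ S : Set (Eu n)) with hB
  have hB0 : volume B = 0 := by
    rw [hB, measure_biUnion_null_iff
      ((V.finite_toSet.finite_subsets).subset fun S hS => hS.1).countable]
    exact fun S hS => Measure.addHaar_submodule _ _ hS.2
  have hpos' := hO.measure_pos volume hne
  obtain ⟨y, ⟨hy1, hy2⟩, hyB⟩ : (({y : Eu n | ∀ ν ∈ facetNormals f, inner ℝ y ν < f ν} ∩
      {y : Eu n | f ν₀ < inner ℝ y ν₀}) \ B).Nonempty := by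
    refine nonempty_of_measure_ne_zero (μ := volume) ?_
    rw [measure_sdiff_null hB0]
    exact hpos'.ne'
  have hy2 : f ν₀ < inner ℝ y ν₀ := hy2
  have hy0 : y ≠ 0 := by
    rintro rfl
    rw [inner_zero_left] at hy2
    linarith
  obtain ⟨ν, g, hν, hg, hgν, hgμ⟩ := exists_support hV hpos hy0
  have hfν := hpos ν (norm_ne_zero_iff.1 (by rw [hν]; exact one_ne_zero))
  have hmem : g⁻¹ • y ∈ Submodule.span ℝ (contact V f ν) := by
    refine hV.mem_span_contact (fun μ => ?_) ?_
    · rw [real_inner_smul_left, inv_mul_le_iff₀ hg]; exact hgμ μ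
    · rw [real_inner_smul_left, hgν]; field_simp
  have hymem : y ∈ Submodule.span ℝ (contact V f ν) := by
    have := Submodule.smul_mem _ g hmem
    rwa [smul_smul, mul_inv_cancel₀ hg.ne', one_smul] at this
  have htop : Submodule.span ℝ (contact V f ν) = ⊤ := by
    by_contra hnt
    exact hyB (mem_biUnion (show contact V f ν ∈ {S : Set (Eu n) | S ⊆ V ∧
      Submodule.span ℝ S ≠ ⊤} from ⟨fun v hv => hv.1, hnt⟩) hymem)
  have h1 := hy1 ν ((mem_facetNormals_iff hV hpos hn).2 ⟨hν, htop⟩)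
  have h2 := hgμ ν₀
  have h3 : 1 < g := by
    by_contra! hle
    nlinarith
  nlinarith

end Positive

end Wulff

/-! ### Translation to polyhedra with normalised normals -/

section Link

variable {n : ℕ} {f : Eu n → ℝ}

/-- The normal of a facet of the Wulff shape, scaled so that its support number becomes one. -/
noncomputable def facetVec (f : Eu n → ℝ) (i : facetNormals f) : Eu n := (f i)⁻¹ • (i : Eu n)

/-- The projection property for polyhedra `hpoly w h`. -/
structure IsProj {ι : Type*} (w : ι → Eu n) (E : Set (Eu n)) (h : ι → ℝ) : Prop where
  near : ∀ i, |h i - 1| < 1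
  slack : ∀ i, HasSlack w h i
  vol : volume (hpoly w h) = volume (hpoly w fun _ => 1)
  vol_sector : ∀ i, volume (E ∩ sector w h i) = volume (hpoly w h ∩ sector w h i)

/-- The properties of the normals of a bounded polytope without redundant inequalities. -/
structure Irredundant {ι : Type*} (w : ι → Eu n) : Prop where
  bounded : ∀ x : Eu n, x ≠ 0 → ∃ i, 0 < inner ℝ x (w i)
  slack : ∀ i, HasSlack w (fun _ => 1) i

variable (hf : IsCrystalline f)

include hf

lemma pos_of_mem_facetNormals {ν : Eu n} (hν : ν ∈ facetNormals f) : 0 < f ν :=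
  hf.1 ν (norm_ne_zero_iff.1 (by rw [hν.1]; exact one_ne_zero))

lemma inner_facetVec_lt_iff (i : facetNormals f) (x : Eu n) (t : ℝ) :
    inner ℝ x (facetVec f i) < t ↔ inner ℝ x (i : Eu n) < f i * t := by
  rw [facetVec, real_inner_smul_right, inv_mul_lt_iff₀ (pos_of_mem_facetNormals hf i.2)]

lemma inner_facetVec_eq_iff (i : facetNormals f) (x : Eu n) (t : ℝ) :
    inner ℝ x (facetVec f i) = t ↔ inner ℝ x (i : Eu n) = f i * t := by
  rw [facetVec, real_inner_smul_right, inv_mul_eq_iff_eq_mul₀ (pos_of_mem_facetNormals hf i.2).ne']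

lemma perturbed_eq_hpoly (a : facetNormals f → ℝ) :
    perturbed f a = hpoly (facetVec f) fun i => 1 + a i := by
  ext x
  exact forall_congr' fun i => (inner_facetVec_lt_iff hf i x _).symm

lemma facetVec_not_parallel (i j : facetNormals f) (hij : i ≠ j) (c : ℝ) (hc : 0 < c) :
    facetVec f j ≠ c • facetVec f i := by
  intro h
  have hi := pos_of_mem_facetNormals hf i.2
  have hj := pos_of_mem_facetNormals hf j.2
  have h1 : (j : Eu n) = (f j * c * (f i)⁻¹) • (i : Eu n) := by
    have := congrArg (fun v => f j • v) h
    simp only [facetVec, smul_smul] at this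
    rw [mul_inv_cancel₀ hj.ne', one_smul] at this
    rw [mul_assoc]
    exact this
  have h2 := congrArg norm h1
  rw [norm_smul, i.2.1, j.2.1, Real.norm_of_nonneg (by positivity), mul_one] at h2
  rw [← h2, one_smul] at h1
  exact hij (Subtype.ext h1.symm)

lemma facetVec_ne_zero (i : facetNormals f) : facetVec f i ≠ 0 :=
  smul_ne_zero (inv_ne_zero (pos_of_mem_facetNormals hf i.2).ne')
    (norm_ne_zero_iff.1 (by rw [i.2.1]; exact one_ne_zero))

variable (hn : 2 ≤ n)

include hn

lemma wulff_eq_hpoly : wulff f = hpoly (facetVec f) fun _ => 1 := by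
  obtain ⟨hpos, V, hV⟩ := hf
  ext x
  constructor
  · intro hx i
    rw [inner_facetVec_lt_iff ⟨hpos, V, hV⟩, mul_one]
    exact hx i i.2.1
  · intro hx
    refine mem_wulff_of_facets hV hpos hn fun ν hν => ?_
    have := hx ⟨ν, hν⟩
    rwa [inner_facetVec_lt_iff ⟨hpos, V, hV⟩, mul_one] at this

/-- Otherwise the whole ray through x would stay in K, contradicting the bound ⟨t x, ν⟩ < f ν for ν
= x / ‖x‖. -/
lemma exists_inner_facetVec_pos {x : Eu n} (hx : x ≠ 0) : ∃ i, 0 < inner ℝ x (facetVec f i) := by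
  by_contra! hcon
  have hmem : ∀ t : ℝ, 0 ≤ t → t * ‖x‖ < f (‖x‖⁻¹ • x) := by
    intro t ht
    have h1 : t • x ∈ wulff f := by
      rw [wulff_eq_hpoly hf hn]
      intro i
      rw [real_inner_smul_left]
      nlinarith [hcon i]
    have h2 := h1 (‖x‖⁻¹ • x) (by
      rw [norm_smul, norm_inv, norm_norm, inv_mul_cancel₀ (norm_ne_zero_iff.2 hx)])
    rw [real_inner_smul_left, real_inner_smul_right, real_inner_self_eq_norm_sq] at h2
    have := norm_pos_iff.2 hx
    have e : ‖x‖⁻¹ * ‖x‖ ^ 2 = ‖x‖ := by field_simp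
    rwa [e] at h2
  have hxn := norm_pos_iff.2 hx
  have h0 := hmem 0 le_rfl
  rw [zero_mul] at h0
  have h1 := hmem (f (‖x‖⁻¹ • x) / ‖x‖) (div_nonneg h0.le hxn.le)
  rw [div_mul_cancel₀ _ hxn.ne'] at h1
  exact h1.ne rfl

lemma finite_index : Finite (facetNormals f) := by
  obtain ⟨hpos, V, hV⟩ := hf
  exact (finite_facetNormals hV hpos hn).to_subtype

lemma nonempty_index : Nonempty (facetNormals f) := by
  have : Nontrivial (Eu n) :=
    Module.nontrivial_of_finrank_pos (R := ℝ) (by simp; omega)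
  obtain ⟨x, hx⟩ := exists_ne (0 : Eu n)
  obtain ⟨i, _⟩ := exists_inner_facetVec_pos hf hn hx
  exact ⟨i⟩

lemma facet_eq {a : facetNormals f → ℝ} (ha : ∀ i, |a i| < 1) (i : facetNormals f) :
    facet f a i = {x | inner ℝ x (facetVec f i) = 1 + a i ∧
      ∀ j, inner ℝ x (facetVec f j) ≤ 1 + a j} := by
  have := finite_index hf hn
  rw [← face_hpoly (facetVec f) (h := fun i => 1 + a i)
    (fun i => by linarith [(abs_lt.1 (ha i)).1]) i, facet, face, perturbed_eq_hpoly hf]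
  simp_rw [inner_facetVec_eq_iff hf]

lemma facetDim_facet_iff {a : facetNormals f → ℝ} (ha : ∀ i, |a i| < 1) (i : facetNormals f) :
    FacetDim (facet f a i) ↔ HasSlack (facetVec f) (fun i => 1 + a i) i := by
  have := finite_index hf hn
  have hpos : ∀ i, 0 < 1 + a i := fun i => by linarith [(abs_lt.1 (ha i)).1]
  rw [facet_eq hf hn ha, facetDim_iff_span hn (hpos i).ne' (fun x hx => hx.1)]
  exact ⟨hasSlack_of_span hpos (facetVec_not_parallel hf) (facetVec_ne_zero hf i),
    span_of_hasSlack (h := fun i => 1 + a i) (hpos i)⟩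

lemma irredundant_facetVec : Irredundant (facetVec f) := by
  refine ⟨fun x hx => exists_inner_facetVec_pos hf hn hx, fun i => ?_⟩
  have h := (facetDim_facet_iff hf hn (a := fun _ => 0) (by simp) i).1 (by
    have := i.2.2
    rw [wulff_eq_hpoly hf hn] at this
    rw [facet, perturbed_eq_hpoly hf]
    simpa using this)
  simpa using h

lemma isProjection_iff {E : Set (Eu n)} {a : facetNormals f → ℝ} :
    IsProjection f E a ↔ IsProj (facetVec f) E fun i => 1 + a i := by
  by_cases ha : ∀ i, |a i| < 1
  · have hpos : ∀ i, 0 < 1 + a i := fun i => by linarith [(abs_lt.1 (ha i)).1]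
    have hcone : ∀ i, HasSlack (facetVec f) (fun i => 1 + a i) i →
        coneOver (facet f a i) = sector (facetVec f) (fun i => 1 + a i) i := fun i hs => by
      rw [facet_eq hf hn ha]
      exact coneOver_eq_sector hpos (fun x hx => exists_inner_facetVec_pos hf hn hx) hs
    rw [IsProjection, IsParallel, perturbed_eq_hpoly hf, wulff_eq_hpoly hf hn]
    constructor
    · rintro ⟨⟨_, h1⟩, h2, h3⟩
      have hs := fun i => (facetDim_facet_iff hf hn ha i).1 (h1 i)
      exact ⟨by simpa using ha, hs, h2, fun i => by rw [← hcone i (hs i)]; exact h3 i⟩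
    · rintro ⟨_, h1, h2, h3⟩
      exact ⟨⟨ha, fun i => (facetDim_facet_iff hf hn ha i).2 (h1 i)⟩, h2,
        fun i => by rw [hcone i (h1 i)]; exact h3 i⟩
  · exact ⟨fun h => absurd h.1.1 ha, fun h => absurd (by simpa using h.near) ha⟩

/-- Each `facetVec f i` is admissible in the supremum, as f equals 1 there. Conversely x / s lies in
K for every s above the maximum, whence ⟨x, ν⟩ ≤ s f(ν) ≤ s. -/
lemma isGreatest_dualGauge (x : Eu n) :
    IsGreatest (range fun i => inner ℝ x (facetVec f i)) (dualGauge f x) := by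
  have := finite_index hf hn
  have := nonempty_index hf hn
  obtain ⟨V, hV⟩ := hf.2
  obtain ⟨i, hi⟩ := Finite.exists_max fun i => inner ℝ x (facetVec f i)
  have hg : IsGreatest {t : ℝ | ∃ ν : Eu n, f ν ≤ 1 ∧ t = inner ℝ x ν}
      (inner ℝ x (facetVec f i)) := by
    refine ⟨⟨facetVec f i, ?_, rfl⟩, ?_⟩
    · have := pos_of_mem_facetNormals hf i.2
      rw [facetVec, Represents.smul hV (inv_nonneg.2 this.le), inv_mul_cancel₀ this.ne']
    · rintro _ ⟨ν, hν, rfl⟩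
      have hnn : 0 ≤ inner ℝ x (facetVec f i) := by
        by_cases hx : x = 0
        · simp [hx]
        · obtain ⟨j, hj⟩ := exists_inner_facetVec_pos hf hn hx
          exact hj.le.trans (hi j)
      refine le_of_forall_gt_imp_ge_of_dense fun s hs => ?_
      have hs0 : 0 < s := hnn.trans_lt hs
      have hmem : s⁻¹ • x ∈ wulff f := by
        rw [wulff_eq_hpoly hf hn]
        intro j
        rw [real_inner_smul_left, inv_mul_lt_iff₀ hs0, mul_one]
        exact (hi j).trans_lt hs
      have := inner_le_of_mem_closure_wulff hV (subset_closure hmem) ν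
      rw [real_inner_smul_left, inv_mul_le_iff₀ hs0] at this
      nlinarith
  rw [dualGauge, hg.csSup_eq]
  exact ⟨⟨i, rfl⟩, by rintro _ ⟨j, rfl⟩; exact hi j⟩

end Link

section Gauge

variable {n : ℕ} {ι : Type*} {w : ι → Eu n} {g : Eu n → ℝ}

/-! ### The gauge of a polytope -/

lemma gauge_lt_iff (hg : ∀ x, IsGreatest (range fun i => inner ℝ x (w i)) (g x)) {x : Eu n}
    {t : ℝ} : g x < t ↔ x ∈ hpoly w fun _ => t := by
  constructor
  · exact fun h i => ((hg x).2 ⟨i, rfl⟩).trans_lt h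
  · intro h
    obtain ⟨i, hi⟩ := (hg x).1
    rw [← hi]
    exact h i

lemma gauge_add_le (hg : ∀ x, IsGreatest (range fun i => inner ℝ x (w i)) (g x)) (x y : Eu n) :
    g (x + y) ≤ g x + g y := by
  obtain ⟨i, hi⟩ := (hg (x + y)).1
  rw [← hi]
  simp only [inner_add_left]
  exact add_le_add ((hg x).2 ⟨i, rfl⟩) ((hg y).2 ⟨i, rfl⟩)

lemma gauge_smul (hg : ∀ x, IsGreatest (range fun i => inner ℝ x (w i)) (g x)) {c : ℝ}
    (hc : 0 ≤ c) (x : Eu n) : g (c • x) = c * g x := by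
  apply le_antisymm
  · obtain ⟨i, hi⟩ := (hg (c • x)).1
    rw [← hi]
    simp only [real_inner_smul_left]
    exact mul_le_mul_of_nonneg_left ((hg x).2 ⟨i, rfl⟩) hc
  · obtain ⟨i, hi⟩ := (hg x).1
    rw [← hi]
    simp only [← real_inner_smul_left]
    exact (hg _).2 ⟨i, rfl⟩

lemma exists_gauge_le [Finite ι] (hg : ∀ x, IsGreatest (range fun i => inner ℝ x (w i)) (g x)) :
    ∃ C, 0 < C ∧ ∀ x, |g x| ≤ C * ‖x‖ := by
  have := Fintype.ofFinite ι
  refine ⟨∑ i, ‖w i‖ + 1, by positivity, fun x => ?_⟩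
  obtain ⟨i, hi⟩ := (hg x).1
  rw [← hi]
  calc |inner ℝ x (w i)| ≤ ‖x‖ * ‖w i‖ := abs_real_inner_le_norm _ _
    _ ≤ ‖x‖ * (∑ i, ‖w i‖ + 1) := by
        gcongr
        have := Finset.single_le_sum (fun i _ => norm_nonneg (w i)) (Finset.mem_univ i)
        linarith
    _ = _ := mul_comm _ _

lemma continuous_gauge [Finite ι] (hg : ∀ x, IsGreatest (range fun i => inner ℝ x (w i)) (g x)) :
    Continuous g := by
  obtain ⟨C, hC, hle⟩ := exists_gauge_le hg
  refine (LipschitzWith.of_le_add_mul (⟨C, hC.le⟩ : NNReal) fun x y => ?_).continuous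
  have h1 := gauge_add_le hg y (x - y)
  rw [add_sub_cancel] at h1
  have h2 := (le_abs_self _).trans (hle (x - y))
  rw [dist_eq_norm]
  exact h1.trans (by gcongr; exact h2)

lemma gauge_pos (hg : ∀ x, IsGreatest (range fun i => inner ℝ x (w i)) (g x))
    (hw : Irredundant w) {x : Eu n} (hx : x ≠ 0) : 0 < g x := by
  obtain ⟨i, hi⟩ := hw.bounded x hx
  exact hi.trans_le ((hg x).2 ⟨i, rfl⟩)

lemma exists_le_gauge [Finite ι] (hg : ∀ x, IsGreatest (range fun i => inner ℝ x (w i)) (g x))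
    (hw : Irredundant w) : ∃ c, 0 < c ∧ ∀ x, c * ‖x‖ ≤ g x := by
  have h0 : g 0 = 0 := by simpa using gauge_smul hg le_rfl (0 : Eu n)
  rcases (sphere (0 : Eu n) 1).eq_empty_or_nonempty with he | hne
  · refine ⟨1, one_pos, fun x => ?_⟩
    by_cases hx : x = 0
    · simp [hx, h0]
    · exfalso
      have : ‖x‖⁻¹ • x ∈ sphere (0 : Eu n) 1 := by
        rw [mem_sphere_zero_iff_norm, norm_smul, norm_inv, norm_norm,
          inv_mul_cancel₀ (norm_ne_zero_iff.2 hx)]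
      rw [he] at this
      exact this
  · obtain ⟨ν, hν, hmin⟩ := (isCompact_sphere (0 : Eu n) 1).exists_isMinOn hne
      (continuous_gauge hg).continuousOn
    refine ⟨g ν, gauge_pos hg hw (norm_ne_zero_iff.1 ?_), fun x => ?_⟩
    · rw [mem_sphere_zero_iff_norm.1 hν]; exact one_ne_zero
    · by_cases hx : x = 0
      · simp [hx, h0]
      have hpos := norm_pos_iff.2 hx
      have : ‖x‖⁻¹ • x ∈ sphere (0 : Eu n) 1 := by
        rw [mem_sphere_zero_iff_norm, norm_smul, norm_inv, norm_norm, inv_mul_cancel₀ hpos.ne']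
      have h1 : g ν ≤ g (‖x‖⁻¹ • x) := hmin this
      rw [gauge_smul hg (by positivity), le_inv_mul_iff₀ hpos] at h1
      linarith

lemma exists_isGreatest [Finite ι] [Nonempty ι] (w : ι → Eu n) :
    ∃ g : Eu n → ℝ, ∀ x, IsGreatest (range fun i => inner ℝ x (w i)) (g x) := by
  have h : ∀ x : Eu n, ∃ t, IsGreatest (range fun i => inner ℝ x (w i)) t := fun x => by
    obtain ⟨i, hi⟩ := Finite.exists_max fun i => inner ℝ x (w i)
    exact ⟨_, ⟨i, rfl⟩, by rintro _ ⟨j, rfl⟩; exact hi j⟩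
  exact ⟨fun x => (h x).choose, fun x => (h x).choose_spec⟩

lemma hpoly_mono {w : ι → Eu n} {h h' : ι → ℝ} (hh : ∀ i, h i ≤ h' i) : hpoly w h ⊆ hpoly w h' :=
  fun _ hx i => (hx i).trans_le (hh i)

lemma Irredundant.exists_hpoly_subset_ball [Finite ι] [Nonempty ι] (hw : Irredundant w) :
    ∃ R, 0 < R ∧ ∀ t, 0 < t → hpoly w (fun _ => t) ⊆ ball 0 (R * t) := by
  obtain ⟨g, hg⟩ := exists_isGreatest w
  obtain ⟨c, hc, hle⟩ := exists_le_gauge hg hw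
  refine ⟨c⁻¹, inv_pos.2 hc, fun t ht x hx => ?_⟩
  have h1 := (hle x).trans_lt ((gauge_lt_iff hg).2 hx)
  rw [mem_ball_zero_iff, lt_inv_mul_iff₀ hc]
  exact h1

lemma Irredundant.volume_hpoly_lt_top [Finite ι] [Nonempty ι] (hw : Irredundant w) (h : ι → ℝ) :
    volume (hpoly w h) < ⊤ := by
  obtain ⟨R, hR, hsub⟩ := hw.exists_hpoly_subset_ball
  obtain ⟨i, hi⟩ := Finite.exists_max h
  refine (measure_mono ?_).trans_lt (measure_ball_lt_top (x := (0 : Eu n))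
    (r := R * (max (h i) 1)))
  exact (hpoly_mono fun j => (hi j).trans (le_max_left _ _)).trans (hsub _ (by positivity))

end Gauge

section Volumes

variable {n : ℕ} {ι : Type*} {w : ι → Eu n}

/-! ### Volumes in cones -/

/-- Stability under multiplication with positive numbers. -/
def IsCone (Q : Set (Eu n)) : Prop := ∀ x ∈ Q, ∀ t : ℝ, 0 < t → t • x ∈ Q

lemma isCone_sector (w : ι → Eu n) (h : ι → ℝ) (i : ι) : IsCone (sector w h i) := by
  intro x hx t ht j
  rw [real_inner_smul_left, real_inner_smul_left]
  have := mul_le_mul_of_nonneg_left (hx j) ht.le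
  linarith

lemma IsCone.diff {Q Q' : Set (Eu n)} (hQ : IsCone Q) (hQ' : IsCone Q') : IsCone (Q \ Q') := by
  rintro x ⟨hx, hx'⟩ t ht
  refine ⟨hQ x hx t ht, fun h => hx' ?_⟩
  have := hQ' _ h t⁻¹ (inv_pos.2 ht)
  rwa [smul_smul, inv_mul_cancel₀ ht.ne', one_smul] at this

open scoped Pointwise in
/-- Scaling a set cut out of a cone. -/
lemma IsCone.volume_real_inter {Q S S' : Set (Eu n)} (hQ : IsCone Q) {t : ℝ} (ht : 0 < t)
    (hS : ∀ x, t • x ∈ S' ↔ x ∈ S) :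
    volume.real (S' ∩ Q) = t ^ n * volume.real (S ∩ Q) := by
  have : S' ∩ Q = t • (S ∩ Q) := by
    ext x
    rw [Set.mem_smul_set]
    constructor
    · rintro ⟨hx, hxQ⟩
      have e : t • t⁻¹ • x = x := by rw [smul_smul, mul_inv_cancel₀ ht.ne', one_smul]
      exact ⟨t⁻¹ • x, ⟨(hS _).1 (by rwa [e]), hQ x hxQ _ (inv_pos.2 ht)⟩, e⟩
    · rintro ⟨y, ⟨hy, hyQ⟩, rfl⟩
      exact ⟨(hS y).2 hy, hQ y hyQ t ht⟩
  rw [this, measureReal_def, Measure.addHaar_smul, ENNReal.toReal_mul, measureReal_def]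
  rw [abs_of_pos (by positivity), ENNReal.toReal_ofReal (by positivity)]
  simp

lemma IsCone.volume_real_hpoly {Q : Set (Eu n)} (hQ : IsCone Q) {t : ℝ} (ht : 0 < t) :
    volume.real (hpoly w (fun _ => t) ∩ Q) =
      t ^ n * volume.real (hpoly w (fun _ => 1) ∩ Q) := by
  refine hQ.volume_real_inter ht fun x => forall_congr' fun i => ?_
  rw [real_inner_smul_left]
  constructor
  · intro h; exact lt_of_mul_lt_mul_left (by linarith) ht.le
  · intro h; nlinarith

lemma IsCone.volume_real_halfspace {Q : Set (Eu n)} (hQ : IsCone Q) (u : Eu n) {t : ℝ}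
    (ht : 0 < t) : volume.real ({x | inner ℝ x u < t} ∩ Q) =
      t ^ n * volume.real ({x | inner ℝ x u < 1} ∩ Q) := by
  refine hQ.volume_real_inter ht fun x => ?_
  simp only [mem_ofPred_eq, real_inner_smul_left]
  constructor
  · intro h; exact lt_of_mul_lt_mul_left (by linarith) ht.le
  · intro h; nlinarith

/-- Inside its sector the i-th inequality implies all the others. -/
lemma hpoly_inter_sector {h : ι → ℝ} (hh : ∀ i, 0 < h i) (i : ι) :
    hpoly w h ∩ sector w h i = {x | inner ℝ x (w i) < h i} ∩ sector w h i := by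
  ext x
  refine and_congr_left fun hx => ⟨fun h' => h' i, fun (h' : inner ℝ x (w i) < h i) j => ?_⟩
  have := hx j
  have := mul_lt_mul_of_pos_left h' (hh j)
  exact lt_of_mul_lt_mul_left (by linarith) (hh i).le

/-- This isolates the factor h i ^ n and thereby turns the projection condition into a fixed point
equation. -/
lemma volume_real_hpoly_inter_sector {h : ι → ℝ} (hh : ∀ i, 0 < h i) (i : ι) :
    volume.real (hpoly w h ∩ sector w h i) =
      h i ^ n * volume.real ({x | inner ℝ x (w i) < 1} ∩ sector w h i) := by
  rw [hpoly_inter_sector hh, (isCone_sector w h i).volume_real_halfspace _ (hh i)]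

/-- The part of a slab in a ball has volume at most proportional to the width of the slab. -/
lemma volume_real_slab_le {R : ℝ} (hR : 0 < R) {u : Eu n} (hu : u ≠ 0) {t : ℝ} (ht : 0 < t) :
    volume.real (ball (0 : Eu n) R ∩ {z | 0 ≤ inner ℝ z u ∧ inner ℝ z u ≤ t}) ≤
      2 * volume.real (ball (0 : Eu n) (2 * R)) / R * (t / ‖u‖) := by
  have hun : 0 < ‖u‖ := norm_pos_iff.2 hu
  set S := ball (0 : Eu n) R ∩ {z | 0 ≤ inner ℝ z u ∧ inner ℝ z u ≤ t} with hS
  set τ := 2 * t / ‖u‖ with hτ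
  have hτ0 : 0 < τ := by positivity
  set e := ‖u‖⁻¹ • u with he
  have heu : inner ℝ e u = ‖u‖ := by
    rw [he, real_inner_smul_left, real_inner_self_eq_norm_sq]; field_simp
  have hen : ‖e‖ = 1 := by rw [he, norm_smul, norm_inv, norm_norm, inv_mul_cancel₀ hun.ne']
  set M := ⌊R / τ⌋₊ + 1 with hM
  have hSm : MeasurableSet S := by
    refine measurableSet_ball.inter (IsClosed.measurableSet ?_)
    have hc : Continuous fun z : Eu n => inner ℝ z u := by fun_prop
    exact (isClosed_le continuous_const hc).inter (isClosed_le hc continuous_const)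
  -- Translates of the slab piece by multiples of τ along the unit normal: each step raises ⟨·, u⟩
  -- by 2t, so they are disjoint, and `M` ≥ R/τ of them fit into the ball of radius 2R.
  let F : ℕ → Set (Eu n) := fun k => (fun z => z + (-(k * τ)) • e) ⁻¹' S
  have hF : ∀ k, volume.real (F k) = volume.real S := fun k => by
    simp only [F, measureReal_def, measure_preimage_add_right]
  have hFm : ∀ k, MeasurableSet (F k) := fun k => (measurable_add_const _) hSm
  have hFin : ∀ k z, z ∈ F k → 2 * k * t ≤ inner ℝ z u ∧ inner ℝ z u ≤ 2 * k * t + t := by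
    intro k z hz
    have h2 : 0 ≤ inner ℝ (z + (-(k * τ)) • e) u ∧ inner ℝ (z + (-(k * τ)) • e) u ≤ t := hz.2
    rw [inner_add_left, real_inner_smul_left, heu] at h2
    have : (k : ℝ) * τ * ‖u‖ = 2 * k * t := by rw [hτ]; field_simp
    constructor <;> linarith [h2.1, h2.2]
  have hdisj : Set.PairwiseDisjoint (↑(Finset.range M)) F := by
    intro k _ l _ hkl
    refine Set.disjoint_left.2 fun z hk hl => ?_
    have h1 := hFin k z hk
    have h2 := hFin l z hl
    rcases lt_or_gt_of_ne hkl with h | h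
    · have : (k : ℝ) + 1 ≤ l := by exact_mod_cast h
      nlinarith
    · have : (l : ℝ) + 1 ≤ k := by exact_mod_cast h
      nlinarith
  have hsub : (⋃ k ∈ Finset.range M, F k) ⊆ ball (0 : Eu n) (2 * R) := by
    refine iUnion₂_subset fun k hk z hz => ?_
    have h1 : ‖z + (-(k * τ)) • e‖ < R := mem_ball_zero_iff.1 hz.1
    have hkM : (k : ℝ) ≤ R / τ := by
      have : k ≤ ⌊R / τ⌋₊ := by
        have := Finset.mem_range.1 hk
        omega
      exact (Nat.cast_le.2 this).trans (Nat.floor_le (by positivity))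
    rw [le_div_iff₀ hτ0] at hkM
    rw [mem_ball_zero_iff]
    calc ‖z‖ = ‖(z + (-(k * τ)) • e) + (k * τ) • e‖ := by rw [neg_smul]; congr 1; abel
      _ ≤ ‖z + (-(k * τ)) • e‖ + ‖((k : ℝ) * τ) • e‖ := norm_add_le _ _
      _ = ‖z + (-(k * τ)) • e‖ + k * τ := by
          rw [norm_smul, hen, mul_one, Real.norm_of_nonneg (by positivity)]
      _ < 2 * R := by linarith
  have hsum : (M : ℝ) * volume.real S ≤ volume.real (ball (0 : Eu n) (2 * R)) := by
    have h1 := measureReal_mono (μ := volume) hsub measure_ball_lt_top.ne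
    rw [measureReal_biUnion_finset hdisj (fun k _ => hFm k)
      (fun k _ => ((measure_mono ((subset_biUnion_of_mem (u := F) (by assumption)).trans
        hsub)).trans_lt measure_ball_lt_top).ne), Finset.sum_congr rfl fun k _ => hF k] at h1
    simpa using h1
  have hMR : R / τ ≤ M := by
    rw [hM]; push_cast; exact (Nat.lt_floor_add_one _).le
  have h3 : R / τ * volume.real S ≤ volume.real (ball (0 : Eu n) (2 * R)) :=
    (mul_le_mul_of_nonneg_right hMR measureReal_nonneg).trans hsum
  rw [div_mul_eq_mul_div, div_le_iff₀ hτ0] at h3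
  rw [div_mul_eq_mul_div, le_div_iff₀ hR]
  calc _ = R * volume.real S := mul_comm _ _
    _ ≤ _ := h3
    _ = _ := by rw [hτ]; ring

lemma isClosed_sector (w : ι → Eu n) (h : ι → ℝ) (i : ι) : IsClosed (sector w h i) := by
  have : sector w h i = ⋂ j, {x | h i * inner ℝ x (w j) ≤ h j * inner ℝ x (w i)} := by
    ext; simp [sector]
  rw [this]
  exact isClosed_iInter fun j => isClosed_le (by fun_prop) (by fun_prop)

lemma Irredundant.not_parallel (hw : Irredundant w) {i j : ι} (hij : i ≠ j) {c : ℝ} (hc : 0 < c) :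
    w j ≠ c • w i := by
  intro h
  obtain ⟨p, hp, hpj⟩ := hw.slack i
  obtain ⟨q, hq, hqi⟩ := hw.slack j
  have h1 := hpj j hij.symm
  have h2 := hqi i hij
  rw [h, real_inner_smul_right] at h1 hq
  rw [hp] at h1
  nlinarith

lemma Irredundant.smul_sub_smul_ne_zero (hw : Irredundant w) {h : ι → ℝ} (hh : ∀ i, 0 < h i) {i j : ι}
    (hij : i ≠ j) : h j • w i - h i • w j ≠ 0 := by
  intro h0
  refine hw.not_parallel hij (div_pos (hh j) (hh i)) ?_
  rw [div_eq_inv_mul, mul_smul, sub_eq_zero.1 h0, smul_smul, inv_mul_cancel₀ (hh i).ne', one_smul]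

/-- A point lies in the sector of an index maximising ⟨x, w i⟩ / h i. Two sectors overlap only in
the hyperplane orthogonal to h j • w i - h i • w j. -/
lemma Irredundant.volume_eq_sum [Fintype ι] [Nonempty ι] (hw : Irredundant w) {h : ι → ℝ}
    (hh : ∀ i, 0 < h i) {S : Set (Eu n)} (hS : MeasurableSet S) :
    volume S = ∑ i, volume (S ∩ sector w h i) := by
  have hcover : S = ⋃ i, S ∩ sector w h i := by
    rw [← inter_iUnion, eq_comm, inter_eq_left]
    intro x _
    obtain ⟨i, hi⟩ := Finite.exists_max fun i => inner ℝ x (w i) / h i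
    refine mem_iUnion.2 ⟨i, fun j => ?_⟩
    have := hi j
    rw [div_le_div_iff₀ (hh j) (hh i)] at this
    linarith
  conv_lhs => rw [hcover]
  rw [measure_iUnion₀, tsum_fintype]
  · intro i j hij
    have hne : Submodule.span ℝ {h j • w i - h i • w j} ≠ ⊥ := by
      rw [Ne, Submodule.span_singleton_eq_bot]; exact hw.smul_sub_smul_ne_zero hh hij
    have hnull : volume ((Submodule.span ℝ {h j • w i - h i • w j})ᗮ : Set (Eu n)) = 0 := by
      refine Measure.addHaar_submodule _ _ fun htop => hne ?_
      rwa [Submodule.orthogonal_eq_top_iff] at htop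
    refine measure_mono_null ?_ hnull
    rintro x ⟨⟨_, hi⟩, ⟨_, hj⟩⟩
    rw [SetLike.mem_coe, Submodule.mem_orthogonal_singleton_iff_inner_left, inner_sub_right,
      real_inner_smul_right, real_inner_smul_right]
    have h1 := hi j
    have h2 := hj i
    linarith
  · exact fun i => (hS.inter (isClosed_sector w h i).measurableSet).nullMeasurableSet

lemma volume_real_pos_of_hasSlack [Finite ι] [Nonempty ι] (hw : Irredundant w) {h : ι → ℝ}
    (hh : ∀ i, 0 < h i) {i : ι} (hs : HasSlack w h i) :
    0 < volume.real (hpoly w h ∩ sector w h i) := by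
  obtain ⟨p, hp, hpj⟩ := hs
  set O := hpoly w h ∩ {x | ∀ j, j ≠ i → h i * inner ℝ x (w j) < h j * inner ℝ x (w i)} with hO
  have hopen : IsOpen O := by
    refine (isOpen_hpoly w h).inter ?_
    have : {x : Eu n | ∀ j, j ≠ i → h i * inner ℝ x (w j) < h j * inner ℝ x (w i)} =
        ⋂ j, ⋂ (_ : j ≠ i), {x | h i * inner ℝ x (w j) < h j * inner ℝ x (w i)} := by ext; simp
    rw [this]
    exact isOpen_iInter_of_finite fun j => isOpen_iInter_of_finite fun _ =>
      isOpen_lt (by fun_prop) (by fun_prop)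
  have hmem : (2⁻¹ : ℝ) • p ∈ O := by
    refine ⟨fun j => ?_, fun j hj => ?_⟩
    · rw [real_inner_smul_left]
      by_cases hj : j = i
      · rw [hj, hp]; linarith [hh i]
      · linarith [hpj j hj, hh j]
    · rw [real_inner_smul_left, real_inner_smul_left, hp]
      nlinarith [hpj j hj, hh i, mul_lt_mul_of_pos_left (hpj j hj) (hh i)]
  have hsub : O ⊆ hpoly w h ∩ sector w h i := by
    rintro x ⟨hx, hx'⟩
    refine ⟨hx, fun j => ?_⟩
    by_cases hj : j = i
    · rw [hj]
    · exact (hx' j hj).le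
  refine ENNReal.toReal_pos ((hopen.measure_pos volume ⟨_, hmem⟩).trans_le
    (measure_mono hsub)).ne' ?_
  exact ((measure_mono inter_subset_left).trans_lt (hw.volume_hpoly_lt_top h)).ne

end Volumes

section Contraction

variable {n : ℕ} {ι : Type*} {w : ι → Eu n}

/-! ### Dependence of the cones on the support numbers -/

lemma Irredundant.eventually_slack [Finite ι] (hw : Irredundant w) :
    ∀ᶠ h : ι → ℝ in 𝓝 1, ∀ i, HasSlack w h i := by
  refine eventually_all.2 fun i => ?_
  obtain ⟨p, hp, hpj⟩ := hw.slack i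
  have : ∀ᶠ h : ι → ℝ in 𝓝 1, ∀ j, j ≠ i → h i * inner ℝ p (w j) < h j := by
    refine eventually_all.2 fun j => ?_
    by_cases hj : j = i
    · simp [hj]
    have h1 : Tendsto (fun h : ι → ℝ => h i * inner ℝ p (w j)) (𝓝 1) (𝓝 (1 * inner ℝ p (w j))) :=
      (Continuous.tendsto (by fun_prop) (1 : ι → ℝ))
    have h2 : Tendsto (fun h : ι → ℝ => h j) (𝓝 1) (𝓝 1) :=
      (Continuous.tendsto (by fun_prop) (1 : ι → ℝ))
    filter_upwards [h1.eventually_lt h2 (by rw [one_mul]; exact hpj j hj)] with h hh _ using hh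
  filter_upwards [this] with h hh
  refine ⟨h i • p, ?_, fun j hj => ?_⟩
  · rw [real_inner_smul_left, hp, mul_one]
  · rw [real_inner_smul_left]; exact hh j hj

/-- A point of K in the sector of h but not in that of h' violates some j-th inequality of h'.
Comparing with the one of h puts it into the slab 0 ≤ ⟨z, h j • w i - h i • w j⟩ ≤ 2sB, and the
lower bound c on the normal vector makes the slab thin. -/
lemma volume_real_sector_diff_le [Fintype ι] {R B c s : ℝ} (hR : 0 < R) (hB : 0 < B) (hc : 0 < c)
    (hs : 0 < s) (hK : hpoly w (fun _ => 1) ⊆ ball 0 R)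
    (hinner : ∀ z ∈ hpoly w (fun _ => 1), ∀ j, |inner ℝ z (w j)| ≤ B) {h h' : ι → ℝ}
    (hhh : ∀ j, |h j - h' j| ≤ s) (i : ι) (hcn : ∀ j, i ≠ j → c ≤ ‖h j • w i - h i • w j‖) :
    volume.real (hpoly w (fun _ => 1) ∩ (sector w h i \ sector w h' i)) ≤
      Fintype.card ι * (2 * volume.real (ball (0 : Eu n) (2 * R)) / R * (2 * B / c)) * s := by
  classical
  let S : ι → Set (Eu n) := fun j =>
    ball (0 : Eu n) R ∩ {z | 0 ≤ inner ℝ z (h j • w i - h i • w j) ∧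
      inner ℝ z (h j • w i - h i • w j) ≤ 2 * s * B}
  have hcov : hpoly w (fun _ => 1) ∩ (sector w h i \ sector w h' i) ⊆
      ⋃ j ∈ Finset.univ.filter (· ≠ i), S j := by
    rintro z ⟨hz, hzh, hzh'⟩
    simp only [sector, mem_ofPred_eq, not_forall, not_le] at hzh'
    obtain ⟨j, hj⟩ := hzh'
    have hji : j ≠ i := by rintro rfl; exact lt_irrefl _ hj
    refine mem_biUnion (show j ∈ Finset.univ.filter (· ≠ i) by simpa using hji) ⟨hK hz, ?_⟩
    have h1 := hzh j
    have h4 : |(h j - h' j) * inner ℝ z (w i)| ≤ s * B := by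
      rw [abs_mul]; exact mul_le_mul (hhh j) (hinner z hz i) (abs_nonneg _) hs.le
    have h5 : |(h i - h' i) * inner ℝ z (w j)| ≤ s * B := by
      rw [abs_mul]; exact mul_le_mul (hhh i) (hinner z hz j) (abs_nonneg _) hs.le
    have h6 := (abs_le.1 h4).2
    have h7 := (abs_le.1 h5).1
    constructor
    · rw [inner_sub_right, real_inner_smul_right, real_inner_smul_right]; linarith
    · rw [inner_sub_right, real_inner_smul_right, real_inner_smul_right]; linarith
  have hSle : ∀ j ∈ Finset.univ.filter (· ≠ i), volume.real (S j) ≤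
      2 * volume.real (ball (0 : Eu n) (2 * R)) / R * (2 * B / c) * s := by
    intro j hj
    have hji : j ≠ i := by simpa using hj
    have hcj := hcn j hji.symm
    have hpos : 0 < 2 * s * B := by positivity
    refine (volume_real_slab_le hR (u := h j • w i - h i • w j)
      (norm_pos_iff.1 (hc.trans_le hcj)) hpos).trans ?_
    rw [mul_assoc _ (2 * B / c)]
    refine mul_le_mul_of_nonneg_left ?_ (by positivity)
    calc 2 * s * B / ‖h j • w i - h i • w j‖ ≤ 2 * s * B / c :=
          div_le_div_of_nonneg_left hpos.le hc hcj
      _ = 2 * B / c * s := by ring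
  calc volume.real (hpoly w (fun _ => 1) ∩ (sector w h i \ sector w h' i))
      ≤ volume.real (⋃ j ∈ Finset.univ.filter (· ≠ i), S j) := by
        refine measureReal_mono hcov ((measure_mono (iUnion₂_subset fun j _ =>
          inter_subset_left)).trans_lt (measure_ball_lt_top (x := (0 : Eu n)) (r := R))).ne
    _ ≤ ∑ j ∈ Finset.univ.filter (· ≠ i), volume.real (S j) := measureReal_biUnion_finset_le _ _
    _ ≤ ∑ j ∈ Finset.univ.filter (· ≠ i),
          2 * volume.real (ball (0 : Eu n) (2 * R)) / R * (2 * B / c) * s :=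
        Finset.sum_le_sum hSle
    _ ≤ ∑ _j : ι, 2 * volume.real (ball (0 : Eu n) (2 * R)) / R * (2 * B / c) * s :=
        Finset.sum_le_sum_of_subset_of_nonneg (Finset.filter_subset _ _)
          fun _ _ _ => by positivity
    _ = _ := by simp only [Finset.sum_const, Finset.card_univ, nsmul_eq_mul]; ring

/-- The part of the unit polytope in which the sectors of `h` and `h'` differ. -/
lemma Irredundant.exists_volume_sector_diff_le [Fintype ι] [Nonempty ι] (hw : Irredundant w) :
    ∃ L : ℝ, 0 ≤ L ∧ ∀ᶠ η : ℝ in 𝓝[>] 0, ∀ h ∈ closedBall (1 : ι → ℝ) η,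
      ∀ h' ∈ closedBall (1 : ι → ℝ) η, ∀ i,
      volume.real (hpoly w (fun _ => 1) ∩ (sector w h i \ sector w h' i)) ≤ L * dist h h' := by
  obtain ⟨R, hR, hball⟩ := hw.exists_hpoly_subset_ball
  have hK := hball 1 one_pos
  rw [mul_one] at hK
  obtain ⟨c, hc, hc0⟩ : ∃ c : ℝ, (∀ i j, i ≠ j → c < ‖w i - w j‖) ∧ 0 < c := by
    have : ∀ᶠ c : ℝ in 𝓝[>] 0, ∀ i j, i ≠ j → c < ‖w i - w j‖ := by
      refine eventually_all.2 fun i => eventually_all.2 fun j => ?_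
      by_cases hij : i = j
      · simp [hij]
      have : 0 < ‖w i - w j‖ := norm_pos_iff.2 (sub_ne_zero.2 fun h =>
        hw.not_parallel hij one_pos (by rw [one_smul, h]))
      filter_upwards [nhdsWithin_le_nhds (gt_mem_nhds this)] with c hc _ using hc
    exact (this.and self_mem_nhdsWithin).exists
  have hB0 : 0 < R * (∑ i, ‖w i‖ + 1) := by positivity
  have hinner : ∀ z ∈ hpoly w (fun _ => 1), ∀ j,
      |inner ℝ z (w j)| ≤ R * (∑ i, ‖w i‖ + 1) := by
    intro z hz j
    have h1 : ‖z‖ < R := mem_ball_zero_iff.1 (hK hz)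
    refine (abs_real_inner_le_norm _ _).trans ?_
    have := Finset.single_le_sum (fun i _ => norm_nonneg (w i)) (Finset.mem_univ j)
    exact mul_le_mul h1.le (by linarith) (norm_nonneg _) hR.le
  have hev : ∀ᶠ h : ι → ℝ in 𝓝 1, ∀ i j, i ≠ j → c < ‖h j • w i - h i • w j‖ := by
    refine eventually_all.2 fun i => eventually_all.2 fun j => ?_
    by_cases hij : i = j
    · simp [hij]
    have h1 : Tendsto (fun h : ι → ℝ => ‖h j • w i - h i • w j‖) (𝓝 1)
        (𝓝 ‖(1 : ℝ) • w i - (1 : ℝ) • w j‖) :=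
      (Continuous.tendsto (by fun_prop) (1 : ι → ℝ))
    rw [one_smul, one_smul] at h1
    filter_upwards [h1.eventually (lt_mem_nhds (hc i j hij))] with h hh _ using hh
  obtain ⟨η₀, hη₀, hsub⟩ := Metric.nhds_basis_closedBall.mem_iff.1 hev
  refine ⟨Fintype.card ι * (2 * volume.real (ball (0 : Eu n) (2 * R)) / R *
    (2 * (R * (∑ i, ‖w i‖ + 1)) / c)), by positivity, ?_⟩
  filter_upwards [Ioo_mem_nhdsGT hη₀] with η hη h hh h' hh' i
  rcases (dist_nonneg (x := h) (y := h')).eq_or_lt with hd | hd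
  · rw [← hd, mul_zero, dist_eq_zero.1 hd.symm]; simp
  refine volume_real_sector_diff_le hR hB0 hc0 hd hK hinner (fun j => ?_) i
    fun j hij => (hsub (closedBall_subset_closedBall hη.2.le hh) i j hij).le
  rw [← Real.dist_eq]
  exact dist_le_pi_dist h h' j

/-! ### The contraction -/

/-- In the cone `Q` the set `S` lies between two dilates of the unit polytope. -/
def Between (w : ι → Eu n) (ε : ℝ) (S Q : Set (Eu n)) : Prop :=
  hpoly w (fun _ => 1 - ε) ∩ Q ⊆ S ∩ Q ∧ S ∩ Q ⊆ hpoly w (fun _ => 1 + ε) ∩ Q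

lemma Between.diff {ε : ℝ} {S Q : Set (Eu n)} (h : Between w ε S Q) (Q' : Set (Eu n)) :
    Between w ε S (Q \ Q') :=
  ⟨fun _ hx => ⟨(h.1 ⟨hx.1, hx.2.1⟩).1, hx.2⟩, fun _ hx => ⟨(h.2 ⟨hx.1, hx.2.1⟩).1, hx.2⟩⟩

lemma Between.volume_real_bounds [Finite ι] [Nonempty ι] (hw : Irredundant w) {ε : ℝ} (hε : 0 ≤ ε) (hε1 : ε < 1)
    {S Q : Set (Eu n)} (h : Between w ε S Q) (hQ : IsCone Q) :
    (1 - ε) ^ n * volume.real (hpoly w (fun _ => 1) ∩ Q) ≤ volume.real (S ∩ Q) ∧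
      volume.real (S ∩ Q) ≤ (1 + ε) ^ n * volume.real (hpoly w (fun _ => 1) ∩ Q) := by
  have hfin := ((measure_mono (μ := volume) (inter_subset_left (s := hpoly w fun _ => 1 + ε)
    (t := Q))).trans_lt (hw.volume_hpoly_lt_top _)).ne
  rw [← hQ.volume_real_hpoly (by linarith), ← hQ.volume_real_hpoly (by linarith)]
  exact ⟨measureReal_mono h.1 (measure_ne_top_of_subset h.2 hfin), measureReal_mono h.2 hfin⟩

/-- The difference of the volumes of two sets close to the unit polytope varies little with the
cone. -/
lemma abs_volume_sub_volume_le [Finite ι] [Nonempty ι] (hw : Irredundant w) {ε : ℝ} (hε : 0 ≤ ε) (hε1 : ε < 1)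
    {S Q Q' : Set (Eu n)} {P : Set (Eu n)} (hQ : IsCone Q) (hQ' : IsCone Q')
    (hQm : MeasurableSet Q) (hQm' : MeasurableSet Q')
    (hS : Between w ε S Q) (hS' : Between w ε S Q') (hP : Between w ε P Q)
    (hP' : Between w ε P Q') :
    |(volume.real (S ∩ Q) - volume.real (P ∩ Q)) - (volume.real (S ∩ Q') - volume.real (P ∩ Q'))|
      ≤ ((1 + ε) ^ n - (1 - ε) ^ n) * (volume.real (hpoly w (fun _ => 1) ∩ (Q \ Q')) +
        volume.real (hpoly w (fun _ => 1) ∩ (Q' \ Q))) ∧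
    |volume.real (P ∩ Q) - volume.real (P ∩ Q')|
      ≤ (1 + ε) ^ n * (volume.real (hpoly w (fun _ => 1) ∩ (Q \ Q')) +
        volume.real (hpoly w (fun _ => 1) ∩ (Q' \ Q))) := by
  have hsplit : ∀ T : Set (Eu n), Between w ε T Q → Between w ε T Q' →
      volume.real (T ∩ Q) - volume.real (T ∩ Q') =
        volume.real (T ∩ (Q \ Q')) - volume.real (T ∩ (Q' \ Q)) := by
    intro T hT hT'
    have e1 := measureReal_inter_add_sdiff (μ := volume) (s := T ∩ Q) hQm'
      (measure_ne_top_of_subset (hT.2.trans inter_subset_left) (hw.volume_hpoly_lt_top _).ne)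
    have e2 := measureReal_inter_add_sdiff (μ := volume) (s := T ∩ Q') hQm
      (measure_ne_top_of_subset (hT'.2.trans inter_subset_left) (hw.volume_hpoly_lt_top _).ne)
    rw [inter_right_comm, inter_sdiff_assoc] at e2
    rw [inter_sdiff_assoc] at e1
    linarith
  have b1 := (hS.diff Q').volume_real_bounds hw hε hε1 (hQ.diff hQ')
  have b2 := (hS'.diff Q).volume_real_bounds hw hε hε1 (hQ'.diff hQ)
  have b3 := (hP.diff Q').volume_real_bounds hw hε hε1 (hQ.diff hQ')
  have b4 := (hP'.diff Q).volume_real_bounds hw hε hε1 (hQ'.diff hQ)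
  have s1 := hsplit S hS hS'
  have s2 := hsplit P hP hP'
  constructor
  · rw [abs_le]
    constructor <;> nlinarith
  · have p1 : 0 ≤ volume.real (P ∩ (Q \ Q')) := measureReal_nonneg
    have p2 : 0 ≤ volume.real (P ∩ (Q' \ Q)) := measureReal_nonneg
    rw [s2, abs_le]
    constructor <;> nlinarith

/-- The half-space `⟨x, w i⟩ < 1` is close to the unit polytope in the `i`-th cone. -/
lemma between_halfspace [Fintype ι] {η : ℝ} (hη : η ≤ 1 / 4) {h : ι → ℝ} (hh : h ∈ closedBall (1 : ι → ℝ) η)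
    (i : ι) : Between w (4 * η) {x | inner ℝ x (w i) < 1} (sector w h i) := by
  have hη0 : 0 ≤ η := dist_nonneg.trans (mem_closedBall.1 hh)
  have habs : ∀ j, |h j - 1| ≤ η := fun j => by
    have := (dist_le_pi_dist h 1 j).trans (mem_closedBall.1 hh)
    rwa [Real.dist_eq] at this
  refine ⟨fun x hx => ⟨(hx.1 i).trans_le (by linarith), hx.2⟩, ?_⟩
  rintro x ⟨(hx : inner ℝ x (w i) < 1), hxs⟩
  refine ⟨fun j => ?_, hxs⟩
  have h1 := hxs j
  have h2 := abs_le.1 (habs i)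
  have h3 := abs_le.1 (habs j)
  -- Hence ⟨x, w j⟩ < h j / h i ≤ (1 + η) / (1 - η) ≤ 1 + 4η.
  have h4 : h i * inner ℝ x (w j) < h j := h1.trans_lt (by nlinarith)
  change inner ℝ x (w j) < 1 + 4 * η
  by_contra! hcon
  nlinarith

lemma between_of_subset {ε ε' : ℝ} (hε : ε ≤ ε') {E : Set (Eu n)}
    (h1 : hpoly w (fun _ => 1 - ε) ⊆ E) (h2 : E ⊆ hpoly w (fun _ => 1 + ε)) (Q : Set (Eu n)) :
    Between w ε' E Q :=
  ⟨fun _ hx => ⟨h1 (hpoly_mono (fun _ => by linarith) hx.1), hx.2⟩,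
    fun _ hx => ⟨hpoly_mono (fun _ => by linarith) (h2 hx.1), hx.2⟩⟩

/-- Both quotients are compared with 1. A change of the denominator enters only multiplied by N' -
D', which is itself of order θ, so the whole bound keeps the small factor θ. -/
lemma abs_div_sub_div_le {N D N' D' D₀ θ C M q : ℝ} (hD₀ : 0 < D₀) (hD : D₀ ≤ D) (hD' : D₀ ≤ D')
    (h1 : |(N - D) - (N' - D')| ≤ θ * q) (h2 : |D - D'| ≤ C * q) (h3 : |N' - D'| ≤ θ * M) :
    |N / D - N' / D'| ≤ θ * (1 / D₀ + M * C / D₀ ^ 2) * q := by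
  have hDp := hD₀.trans_le hD
  have hDp' := hD₀.trans_le hD'
  have e : N / D - N' / D' =
      ((N - D) - (N' - D')) / D + (N' - D') * (D' - D) / (D * D') := by
    field_simp; ring
  have a1 : |((N - D) - (N' - D')) / D| ≤ θ * q / D₀ := by
    rw [abs_div, abs_of_pos hDp]
    exact div_le_div₀ ((abs_nonneg _).trans h1) h1 hD₀ hD
  have a2 : |(N' - D') * (D' - D) / (D * D')| ≤ θ * M * (C * q) / D₀ ^ 2 := by
    rw [abs_div, abs_of_pos (mul_pos hDp hDp'), abs_mul, abs_sub_comm D' D]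
    have h0 : 0 ≤ θ * M * (C * q) :=
      mul_nonneg ((abs_nonneg _).trans h3) ((abs_nonneg _).trans h2)
    refine div_le_div₀ h0 (mul_le_mul h3 h2 (abs_nonneg _) ((abs_nonneg _).trans h3))
      (by positivity) ?_
    nlinarith
  rw [e]
  refine (abs_add_le _ _).trans ((add_le_add a1 a2).trans (le_of_eq ?_))
  ring

lemma abs_sub_le_of_pow {n : ℕ} {u v : ℝ} (hu : 1 / 2 ≤ u) (hv : 1 / 2 ≤ v) (hn : n ≠ 0) :
    |u - v| ≤ 2 ^ n * |u ^ n - v ^ n| := by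
  wlog huv : v ≤ u generalizing u v
  · rw [abs_sub_comm, abs_sub_comm (u ^ n)]
    exact this hv hu (le_of_not_ge huv)
  have h1 : v ^ n ≤ u ^ n := pow_le_pow_left₀ (by linarith) huv n
  rw [abs_of_nonneg (sub_nonneg.2 huv), abs_of_nonneg (sub_nonneg.2 h1)]
  obtain ⟨k, rfl⟩ := Nat.exists_eq_add_one_of_ne_zero hn
  have h2 : (1 / 2 : ℝ) ^ k ≤ u ^ k := pow_le_pow_left₀ (by norm_num) hu k
  have h3 : v ^ k ≤ u ^ k := pow_le_pow_left₀ (by linarith) huv k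
  have h4 : (1 / 2 : ℝ) ^ k * (u - v) ≤ u ^ (k + 1) - v ^ (k + 1) := by
    have : u ^ (k + 1) - v ^ (k + 1) = u ^ k * (u - v) + (u ^ k - v ^ k) * v := by ring
    rw [this]
    have := mul_le_mul_of_nonneg_right h2 (sub_nonneg.2 huv)
    have := mul_nonneg (sub_nonneg.2 h3) (by linarith : (0 : ℝ) ≤ v)
    linarith
  have h5 : (2 : ℝ) ^ k * (1 / 2) ^ k = 1 := by rw [← mul_pow]; norm_num
  have h6 := mul_le_mul_of_nonneg_left h4 (by positivity : (0 : ℝ) ≤ 2 ^ k)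
  rw [← mul_assoc, h5, one_mul] at h6
  rw [pow_succ]
  nlinarith [sub_nonneg.2 h1, (by positivity : (0 : ℝ) < 2 ^ k)]

end Contraction

section Projection

variable {n : ℕ} {ι : Type*} [Fintype ι] [Nonempty ι] {w : ι → Eu n}

/-! ### Projections as fixed points -/

/-- The volume of `E` in the `i`-th cone relative to the volume below the `i`-th facet of the unit
polytope. -/
noncomputable def ratio {ι : Type*} (w : ι → Eu n) (E : Set (Eu n)) (h : ι → ℝ) (i : ι) : ℝ :=
  volume.real (E ∩ sector w h i) / volume.real ({x | inner ℝ x (w i) < 1} ∩ sector w h i)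

/-- Quantitative assumptions under which the projection is the fixed point of a contraction. -/
structure Regime (w : ι → Eu n) (η D L : ℝ) : Prop where
  irr : Irredundant w
  pos : 0 < η
  small : η ≤ 1 / 6
  posD : 0 < D
  nonnegL : 0 ≤ L
  slack : ∀ h ∈ closedBall (1 : ι → ℝ) η, ∀ i, HasSlack w h i
  lip : ∀ h ∈ closedBall (1 : ι → ℝ) η, ∀ h' ∈ closedBall (1 : ι → ℝ) η, ∀ i,
    volume.real (hpoly w (fun _ => 1) ∩ (sector w h i \ sector w h' i)) ≤ L * dist h h'
  lower : ∀ h ∈ closedBall (1 : ι → ℝ) η, ∀ i,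
    D ≤ volume.real (hpoly w (fun _ => 1) ∩ sector w h i)

lemma abs_sub_one_le {ι : Type*} [Fintype ι] {η : ℝ} {h : ι → ℝ} (hh : h ∈ closedBall (1 : ι → ℝ) η) (i : ι) :
    |h i - 1| ≤ η := by
  have := (dist_le_pi_dist h 1 i).trans (mem_closedBall.1 hh)
  rwa [Real.dist_eq] at this

/-- D is half the smallest sector volume of K at h = 1; moving h by η costs at most L η, which is
less than D for small η. That D and L do not depend on η lets η be chosen later to make the map
contract. -/
lemma Irredundant.exists_regime (hw : Irredundant w) :
    ∃ D L : ℝ, 0 < D ∧ 0 ≤ L ∧ ∀ᶠ η in 𝓝[>] (0 : ℝ), Regime w η D L := by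
  obtain ⟨L, hL, hlip⟩ := hw.exists_volume_sector_diff_le
  obtain ⟨i₀, hi₀⟩ := Finite.exists_min fun i =>
    volume.real (hpoly w (fun _ => 1) ∩ sector w (fun _ => 1) i)
  have hV := volume_real_pos_of_hasSlack hw (h := fun _ => 1) (fun _ => one_pos) (hw.slack i₀)
  set V := volume.real (hpoly w (fun _ => 1) ∩ sector w (fun _ => 1) i₀) with hVdef
  obtain ⟨η₁, hη₁, hsl⟩ := Metric.nhds_basis_closedBall.mem_iff.1 hw.eventually_slack
  refine ⟨V / 2, L, half_pos hV, hL, ?_⟩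
  have hpos : 0 < V / (2 * (L + 1)) := by positivity
  filter_upwards [hlip, Ioo_mem_nhdsGT hη₁, Ioo_mem_nhdsGT (show (0 : ℝ) < 1 / 6 by norm_num),
    Ioo_mem_nhdsGT hpos] with η hlip h1 h2 h3
  refine ⟨hw, h1.1, h2.2.le, half_pos hV, hL,
    fun h hh => hsl (closedBall_subset_closedBall h1.2.le hh), hlip, fun h hh i => ?_⟩
  have h1m : (1 : ι → ℝ) ∈ closedBall (1 : ι → ℝ) η := mem_closedBall_self h1.1.le
  have e1 := hlip 1 h1m h hh i
  have e2 : dist 1 h ≤ η := by rw [dist_comm]; exact hh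
  have e3 := hi₀ i
  have e4 := measureReal_inter_add_sdiff (μ := volume)
    (s := hpoly w (fun _ => 1) ∩ sector w (fun _ => 1) i)
    (isClosed_sector w h i).measurableSet
    (measure_ne_top_of_subset inter_subset_left (hw.volume_hpoly_lt_top _).ne)
  have e5 : volume.real (hpoly w (fun _ => 1) ∩ sector w (fun _ => 1) i ∩ sector w h i) ≤
      volume.real (hpoly w (fun _ => 1) ∩ sector w h i) :=
    measureReal_mono (fun x hx => ⟨hx.1.1, hx.2⟩)
      (measure_ne_top_of_subset inter_subset_left (hw.volume_hpoly_lt_top _).ne)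
  rw [inter_sdiff_assoc] at e4
  have e6 : L * dist 1 h ≤ V / 2 := by
    have := (lt_div_iff₀ (by positivity)).1 h3.2
    nlinarith [mul_le_mul_of_nonneg_left e2 hL, h1.1]
  have e7 : volume.real (hpoly w (fun _ => 1) ∩ (sector w (fun _ => 1) i \ sector w h i)) ≤
    L * dist 1 h := e1
  have e8 : V ≤ volume.real (hpoly w (fun _ => 1) ∩ sector w (fun _ => 1) i) := e3
  linarith

namespace Regime

variable {η D L : ℝ}

lemma halfspace_lower (H : Regime w η D L) {h : ι → ℝ} (hh : h ∈ closedBall (1 : ι → ℝ) η)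
    (i : ι) : D ≤ volume.real ({x | inner ℝ x (w i) < 1} ∩ sector w h i) := by
  refine (H.lower h hh i).trans (measureReal_mono (fun x hx => ⟨hx.1 i, hx.2⟩) ?_)
  exact measure_ne_top_of_subset ((between_halfspace (by linarith [H.small]) hh i).2.trans
    inter_subset_left) (H.irr.volume_hpoly_lt_top _).ne

variable {ε : ℝ} {E : Set (Eu n)}

lemma abs_volume_sub_le (hw : Irredundant w) {ε : ℝ} (hε : 0 ≤ ε) (hε1 : ε < 1)
    {S P Q : Set (Eu n)} (hQ : IsCone Q) (hS : Between w ε S Q) (hP : Between w ε P Q) :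
    |volume.real (S ∩ Q) - volume.real (P ∩ Q)| ≤
      ((1 + ε) ^ n - (1 - ε) ^ n) * volume.real (hpoly w fun _ => 1) := by
  have b1 := hS.volume_real_bounds hw hε hε1 hQ
  have b2 := hP.volume_real_bounds hw hε hε1 hQ
  have h1 : volume.real (hpoly w (fun _ => 1) ∩ Q) ≤ volume.real (hpoly w fun _ => 1) :=
    measureReal_mono inter_subset_left (hw.volume_hpoly_lt_top _).ne
  have h2 : 0 ≤ (1 + ε) ^ n - (1 - ε) ^ n :=
    sub_nonneg.2 (pow_le_pow_left₀ (by linarith) (by linarith) n)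
  have h3 := mul_le_mul_of_nonneg_left h1 h2
  rw [abs_le]
  constructor <;> linarith

/-- The Lipschitz constant carries the factor (1 + 4η)^n - (1 - 4η)^n, which tends to 0 with η while
D and L stay fixed. -/
lemma abs_ratio_sub_ratio_le (H : Regime w η D L) (hε : ε ≤ 4 * η)
    (hE1 : hpoly w (fun _ => 1 - ε) ⊆ E) (hE2 : E ⊆ hpoly w (fun _ => 1 + ε))
    {h h' : ι → ℝ} (hh : h ∈ closedBall (1 : ι → ℝ) η) (hh' : h' ∈ closedBall (1 : ι → ℝ) η)
    (i : ι) : |ratio w E h i - ratio w E h' i| ≤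
      ((1 + 4 * η) ^ n - (1 - 4 * η) ^ n) *
        (1 / D + volume.real (hpoly w fun _ => 1) * 2 ^ n / D ^ 2) * (2 * L * dist h h') := by
  have hη := H.small
  have hη0 := H.pos
  have key := abs_volume_sub_volume_le H.irr (ε := 4 * η) (by linarith) (by linarith)
    (isCone_sector w h i) (isCone_sector w h' i) (isClosed_sector w h i).measurableSet
    (isClosed_sector w h' i).measurableSet (between_of_subset hε hE1 hE2 _)
    (between_of_subset hε hE1 hE2 _) (between_halfspace (by linarith) hh i)
    (between_halfspace (by linarith) hh' i)
  have hq : volume.real (hpoly w (fun _ => 1) ∩ (sector w h i \ sector w h' i)) +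
      volume.real (hpoly w (fun _ => 1) ∩ (sector w h' i \ sector w h i)) ≤
        2 * L * dist h h' := by
    have h1 := H.lip h hh h' hh' i
    have h2 := H.lip h' hh' h hh i
    rw [dist_comm h' h] at h2
    linarith
  have h2 : 0 ≤ (1 + 4 * η) ^ n - (1 - 4 * η) ^ n :=
    sub_nonneg.2 (pow_le_pow_left₀ (by linarith) (by linarith) n)
  have h3 : (1 + 4 * η) ^ n ≤ 2 ^ n := pow_le_pow_left₀ (by linarith) (by linarith) n
  refine abs_div_sub_div_le H.posD (H.halfspace_lower hh i) (H.halfspace_lower hh' i)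
    (key.1.trans (mul_le_mul_of_nonneg_left hq h2))
    (key.2.trans (mul_le_mul h3 hq (by positivity) (by positivity))) ?_
  exact abs_volume_sub_le H.irr (by linarith) (by linarith) (isCone_sector w h' i)
    (between_of_subset hε hE1 hE2 _) (between_halfspace (by linarith) hh' i)

lemma abs_ratio_sub_one_le (H : Regime w η D L) {ε' : ℝ} (hε0 : 0 ≤ ε') (hε1 : ε' < 1)
    (hε : ε ≤ ε') (hE1 : hpoly w (fun _ => 1 - ε) ⊆ E) (hE2 : E ⊆ hpoly w (fun _ => 1 + ε))
    {h : ι → ℝ} (hh : h ∈ closedBall (1 : ι → ℝ) η) (i : ι)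
    (hP : Between w ε' {x | inner ℝ x (w i) < 1} (sector w h i)) :
    |ratio w E h i - 1| ≤
      ((1 + ε') ^ n - (1 - ε') ^ n) * volume.real (hpoly w fun _ => 1) / D := by
  have hD := H.halfspace_lower hh i
  have hDp := H.posD.trans_le hD
  have := abs_volume_sub_le H.irr hε0 hε1 (isCone_sector w h i)
    (between_of_subset hε hE1 hE2 _) hP
  rw [ratio, div_sub_one hDp.ne', abs_div, abs_of_pos hDp]
  exact div_le_div₀ ((abs_nonneg _).trans this) this H.posD hD

/-- The total volume condition comes for free: the sectors cover the space with null overlaps, so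
the conditions in the cones add up to |E| = |K^a|. -/
lemma isProj_iff (H : Regime w η D L) (hEm : MeasurableSet E)
    (hE : volume E = volume (hpoly w fun _ => 1)) {h : ι → ℝ}
    (hh : h ∈ closedBall (1 : ι → ℝ) η) : IsProj w E h ↔ ∀ i, ratio w E h i = h i ^ n := by
  have habs := abs_sub_one_le hh
  have hpos : ∀ i, 0 < h i := fun i => by linarith [(abs_le.1 (habs i)).1, H.small]
  have hfinE : volume E ≠ ⊤ := hE ▸ (H.irr.volume_hpoly_lt_top _).ne
  have hfin := (H.irr.volume_hpoly_lt_top h).ne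
  have hiff : ∀ i, volume (E ∩ sector w h i) = volume (hpoly w h ∩ sector w h i) ↔
      ratio w E h i = h i ^ n := fun i => by
    rw [ratio, div_eq_iff (H.posD.trans_le (H.halfspace_lower hh i)).ne',
      ← volume_real_hpoly_inter_sector hpos, measureReal_def, measureReal_def,
      ENNReal.toReal_eq_toReal_iff' (measure_ne_top_of_subset inter_subset_left hfinE)
        (measure_ne_top_of_subset inter_subset_left hfin)]
  constructor
  · exact fun hp i => (hiff i).1 (hp.vol_sector i)
  · intro hr
    have hs := fun i => (hiff i).2 (hr i)
    refine ⟨fun i => (habs i).trans_lt (by linarith [H.small]), H.slack h hh, ?_, hs⟩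
    rw [← hE, H.irr.volume_eq_sum hpos (isOpen_hpoly w h).measurableSet,
      H.irr.volume_eq_sum hpos hEm]
    exact Finset.sum_congr rfl fun i _ => (hs i).symm

/-- The contraction principle for the projection. -/
lemma existsUnique (H : Regime w η D L) (hn : n ≠ 0) (hε : ε ≤ 4 * η) (hε0 : 0 ≤ ε)
    (hE1 : hpoly w (fun _ => 1 - ε) ⊆ E) (hE2 : E ⊆ hpoly w (fun _ => 1 + ε))
    (hc1 : 2 ^ n * (((1 + 4 * η) ^ n - (1 - 4 * η) ^ n) *
      (1 / D + volume.real (hpoly w fun _ => 1) * 2 ^ n / D ^ 2) * (2 * L)) ≤ 1 / 2)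
    (hc2 : ((1 + 4 * η) ^ n - (1 - 4 * η) ^ n) * volume.real (hpoly w fun _ => 1) / D ≤ 1 / 2)
    (hc3 : 2 ^ n * (((1 + ε) ^ n - (1 - ε) ^ n) * volume.real (hpoly w fun _ => 1) / D)
      ≤ η / 2) :
    ∃! h : ι → ℝ, h ∈ closedBall (1 : ι → ℝ) η ∧ ∀ i, ratio w E h i = h i ^ n := by
  have hη := H.small
  have hη0 := H.pos
  let T : (ι → ℝ) → ι → ℝ := fun h i => (ratio w E h i) ^ ((n : ℝ)⁻¹)
  have hhalf : ∀ h ∈ closedBall (1 : ι → ℝ) η, ∀ i, 1 / 2 ≤ ratio w E h i := by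
    intro h hh i
    have := (H.abs_ratio_sub_one_le (by linarith) (by linarith) hε hE1 hE2 hh i
      (between_halfspace (by linarith) hh i)).trans hc2
    linarith [(abs_le.1 this).1]
  have hTpow : ∀ h ∈ closedBall (1 : ι → ℝ) η, ∀ i, T h i ^ n = ratio w E h i := fun h hh i =>
    Real.rpow_inv_natCast_pow (by linarith [hhalf h hh i]) hn
  have hT0 : ∀ h ∈ closedBall (1 : ι → ℝ) η, ∀ i, 0 ≤ T h i := fun h hh i =>
    Real.rpow_nonneg (by linarith [hhalf h hh i]) _
  have hThalf : ∀ h ∈ closedBall (1 : ι → ℝ) η, ∀ i, 1 / 2 ≤ T h i := by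
    intro h hh i
    refine le_of_pow_le_pow_left₀ hn (hT0 h hh i) ?_
    rw [hTpow h hh]
    refine le_trans ?_ (hhalf h hh i)
    exact pow_le_of_le_one (by norm_num) (by norm_num) hn
  have hfix : ∀ h ∈ closedBall (1 : ι → ℝ) η, (T h = h ↔ ∀ i, ratio w E h i = h i ^ n) := by
    intro h hh
    rw [funext_iff]
    refine forall_congr' fun i => ?_
    have h0 : 0 ≤ h i := by linarith [(abs_le.1 (abs_sub_one_le hh i)).1]
    rw [← hTpow h hh, pow_left_inj₀ (hT0 h hh i) h0 hn]
  have hlip : ∀ h ∈ closedBall (1 : ι → ℝ) η, ∀ h' ∈ closedBall (1 : ι → ℝ) η,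
      dist (T h) (T h') ≤ 1 / 2 * dist h h' := by
    intro h hh h' hh'
    refine (dist_pi_le_iff (by positivity)).2 fun i => ?_
    rw [Real.dist_eq]
    refine (abs_sub_le_of_pow (hThalf h hh i) (hThalf h' hh' i) hn).trans ?_
    rw [hTpow h hh, hTpow h' hh']
    refine (mul_le_mul_of_nonneg_left (H.abs_ratio_sub_ratio_le hε hE1 hE2 hh hh' i)
      (by positivity)).trans ?_
    calc _ = 2 ^ n * (((1 + 4 * η) ^ n - (1 - 4 * η) ^ n) *
      (1 / D + volume.real (hpoly w fun _ => 1) * 2 ^ n / D ^ 2) * (2 * L)) * dist h h' := by ring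
      _ ≤ _ := mul_le_mul_of_nonneg_right hc1 dist_nonneg
  have h1m : (1 : ι → ℝ) ∈ closedBall (1 : ι → ℝ) η := mem_closedBall_self hη0.le
  -- With Lipschitz constant 1/2, a displacement of at most η/2 at the centre makes T map the ball
  -- of radius η into itself.
  have hT1 : dist (T 1) 1 ≤ η / 2 := by
    refine (dist_pi_le_iff (by positivity)).2 fun i => ?_
    rw [Real.dist_eq, Pi.one_apply]
    refine (abs_sub_le_of_pow (hThalf 1 h1m i) (by norm_num) hn).trans ?_
    rw [hTpow 1 h1m, one_pow]
    refine (mul_le_mul_of_nonneg_left (H.abs_ratio_sub_one_le hε0 (by linarith) le_rfl hE1 hE2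
      h1m i ?_) (by positivity)).trans hc3
    -- At h = 1 the half-space agrees with K inside the sector, so the bound is in terms of ε
    -- instead of 4η and can be made small compared with η.
    have := between_halfspace (w := w) (η := 0) (by norm_num)
      (mem_closedBall_self (x := (1 : ι → ℝ)) le_rfl) i
    rw [mul_zero] at this
    exact ⟨fun x hx => this.1 ⟨hpoly_mono (fun _ => by linarith) hx.1, hx.2⟩,
      fun x hx => ⟨hpoly_mono (fun _ => by linarith) (this.2 hx).1, hx.2⟩⟩
  have hmaps : MapsTo T (closedBall (1 : ι → ℝ) η) (closedBall (1 : ι → ℝ) η) := by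
    intro h hh
    rw [mem_closedBall]
    have h1 := hlip h hh 1 h1m
    have h2 := dist_triangle (T h) (T 1) 1
    have h3 : dist h 1 ≤ η := hh
    linarith
  have hcontr : ContractingWith (1 / 2) (hmaps.restrict T _ _) := by
    refine ⟨by rw [← NNReal.coe_lt_coe]; norm_num, LipschitzWith.of_dist_le_mul fun x y => ?_⟩
    have h1 : dist (T x) (T y) ≤ 1 / 2 * dist (x : ι → ℝ) y := hlip x x.2 y y.2
    change dist (T x) (T y) ≤ ((1 / 2 : NNReal) : ℝ) * dist (x : ι → ℝ) y
    simpa using h1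
  obtain ⟨h, hh, hfp, _⟩ := hcontr.exists_fixedPoint' isClosed_closedBall.isComplete hmaps h1m
    (edist_ne_top _ _)
  refine ⟨h, ⟨hh, (hfix h hh).1 hfp⟩, ?_⟩
  rintro h' ⟨hh', hfp'⟩
  have e1 : T h' = h' := (hfix h' hh').2 hfp'
  have e2 : T h = h := hfp
  have e3 := hlip h' hh' h hh
  rw [e1, e2] at e3
  exact dist_le_zero.1 (by linarith [dist_nonneg (x := h') (y := h)])

end Regime

/-! ### A priori bounds and the existence theorem -/

/-- In the i-th cone E stays below ⟨x, w i⟩ = 1 + ε, so its volume there, which is h i ^ n times V,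
is at most (1 + ε)^n V. -/
lemma IsProj.le_one_add (hw : Irredundant w) (hn : n ≠ 0) {E : Set (Eu n)} {ε : ℝ} (hε : 0 < ε)
    (hE2 : E ⊆ hpoly w (fun _ => 1 + ε)) {h : ι → ℝ} (hp : IsProj w E h) (i : ι) :
    h i ≤ 1 + ε := by
  have hpos : ∀ i, 0 < h i := fun i => by linarith [(abs_lt.1 (hp.near i)).1]
  set V := volume.real ({x | inner ℝ x (w i) < 1} ∩ sector w h i) with hV
  have h1 := volume_real_pos_of_hasSlack hw hpos (hp.slack i)
  have h2 := volume_real_hpoly_inter_sector (w := w) hpos i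
  rw [h2] at h1
  have hVpos : 0 < V := pos_of_mul_pos_right h1 (pow_pos (hpos i) n).le
  -- An infinite volume would have real value 0, whereas scaling gives a positive value.
  have hfinV : volume ({x | inner ℝ x (w i) < 1 + ε} ∩ sector w h i) ≠ ⊤ := by
    intro htop
    have := (isCone_sector w h i).volume_real_halfspace (w i) (by linarith : 0 < 1 + ε)
    rw [measureReal_def, htop, ENNReal.toReal_top] at this
    have : 0 < (1 + ε) ^ n * V := by positivity
    linarith
  have h3 : volume.real (E ∩ sector w h i) ≤ (1 + ε) ^ n * V := by
    rw [hV, ← (isCone_sector w h i).volume_real_halfspace (w i) (by linarith : 0 < 1 + ε)]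
    exact measureReal_mono (fun x hx => ⟨hE2 hx.1 i, hx.2⟩) hfinV
  have h4 : volume.real (E ∩ sector w h i) = h i ^ n * V := by
    rw [measureReal_def, hp.vol_sector i, ← measureReal_def, h2]
  rw [h4] at h3
  exact le_of_pow_le_pow_left₀ hn (by linarith) (le_of_mul_le_mul_right h3 hVpos)

lemma Irredundant.exists_cap_volume (hw : Irredundant w) {η : ℝ} (hη : 0 < η) :
    ∃ v, 0 < v ∧ ∀ i, v ≤ volume.real (hpoly w (fun _ => 1) ∩ {x | 1 - η < inner ℝ x (w i)}) := by
  obtain ⟨i, hi⟩ := Finite.exists_min fun i =>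
    volume.real (hpoly w (fun _ => 1) ∩ {x | 1 - η < inner ℝ x (w i)})
  refine ⟨_, ?_, hi⟩
  have hopen : IsOpen (hpoly w (fun _ => 1) ∩ {x | 1 - η < inner ℝ x (w i)}) :=
    (isOpen_hpoly w _).inter (isOpen_lt continuous_const (by fun_prop))
  obtain ⟨p, hp, hpj⟩ := hw.slack i
  have hmem : (max (1 / 2) (1 - η / 2)) • p ∈
      hpoly w (fun _ => 1) ∩ {x | 1 - η < inner ℝ x (w i)} := by
    have h1 : max (1 / 2) (1 - η / 2) < 1 := max_lt (by norm_num) (by linarith)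
    have h2 : 1 / 2 ≤ max (1 / 2) (1 - η / 2) := le_max_left _ _
    have h3 : 1 - η / 2 ≤ max (1 / 2) (1 - η / 2) := le_max_right _ _
    refine ⟨fun j => ?_, ?_⟩
    · rw [real_inner_smul_left]
      by_cases hj : j = i
      · rw [hj, hp]; linarith
      · have := hpj j hj
        nlinarith
    · change 1 - η < inner ℝ _ (w i)
      rw [real_inner_smul_left, hp]; linarith
  exact ENNReal.toReal_pos (hopen.measure_pos volume ⟨_, hmem⟩).ne'
    (measure_ne_top_of_subset inter_subset_left (hw.volume_hpoly_lt_top _).ne)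

/-- By the upper bounds K^a lies in (1 + ε)K. If h i < 1 - η it would also miss the i-th cap of K,
whose volume v exceeds |(1 + ε)K| - |K|, and so have less volume than K. -/
lemma IsProj.one_sub_le (hw : Irredundant w) (hn : n ≠ 0) {E : Set (Eu n)} {ε η v : ℝ}
    (hε : 0 < ε) (hE2 : E ⊆ hpoly w (fun _ => 1 + ε))
    (hv : ∀ i, v ≤ volume.real (hpoly w (fun _ => 1) ∩ {x | 1 - η < inner ℝ x (w i)}))
    (hεv : ((1 + ε) ^ n - 1) * volume.real (hpoly w fun _ => 1) < v)
    {h : ι → ℝ} (hp : IsProj w E h) (i : ι) : 1 - η ≤ h i := by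
  by_contra! hcon
  set C := hpoly w (fun _ => 1) ∩ {x | 1 - η < inner ℝ x (w i)} with hC
  have hCm : MeasurableSet C :=
    ((isOpen_hpoly w _).inter (isOpen_lt continuous_const (by fun_prop))).measurableSet
  have hfin := fun t : ι → ℝ => (hw.volume_hpoly_lt_top t).ne
  have hsub : hpoly w h ⊆ hpoly w (fun _ => 1 + ε) \ C := fun x hx =>
    ⟨hpoly_mono (fun j => hp.le_one_add hw hn hε hE2 j) hx,
      fun hxC => lt_irrefl _ (((hx i).trans hcon).trans hxC.2)⟩
  have h1 := measureReal_mono (μ := volume) hsub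
    (measure_ne_top_of_subset sdiff_subset (hfin _))
  have h2 := measureReal_sdiff_add_inter (μ := volume) (s := hpoly w (fun _ => 1 + ε)) hCm
    (hfin _)
  have h3 : hpoly w (fun _ => 1 + ε) ∩ C = C :=
    inter_eq_right.2 (inter_subset_left.trans (hpoly_mono fun _ => by linarith))
  rw [h3] at h2
  have h4 : volume.real (hpoly w fun _ => 1 + ε) =
      (1 + ε) ^ n * volume.real (hpoly w fun _ => 1) := by
    have := IsCone.volume_real_hpoly (w := w) (Q := univ) (fun _ _ _ _ => mem_univ _)
      (by linarith : 0 < 1 + ε)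
    simpa using this
  have h5 : volume.real (hpoly w h) = volume.real (hpoly w fun _ => 1) := by
    rw [measureReal_def, hp.vol, ← measureReal_def]
  have h6 := hv i
  rw [h5] at h1
  linarith

lemma tendsto_pow_sub_pow (n : ℕ) (c : ℝ) :
    Tendsto (fun ε : ℝ => (1 + c * ε) ^ n - (1 - c * ε) ^ n) (𝓝[>] 0) (𝓝 0) := by
  have : Continuous fun ε : ℝ => (1 + c * ε) ^ n - (1 - c * ε) ^ n := by fun_prop
  have h := this.tendsto 0
  simp only [mul_zero, add_zero, sub_zero, one_pow, sub_self] at h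
  exact h.mono_left nhdsWithin_le_nhds

/-- Existence, uniqueness and smallness of the projection of sets close to a polytope. -/
theorem Irredundant.exists_projection (hw : Irredundant w) (hn : n ≠ 0) {η₀ : ℝ} (hη₀ : 0 < η₀) :
    ∃ ε₁ : ℝ, 0 < ε₁ ∧ ∀ ε, 0 < ε → ε ≤ ε₁ → ∀ E : Set (Eu n), MeasurableSet E →
      hpoly w (fun _ => 1 - ε) ⊆ E → E ⊆ hpoly w (fun _ => 1 + ε) →
      volume E = volume (hpoly w fun _ => 1) →
      (∃! h : ι → ℝ, IsProj w E h) ∧ ∀ h : ι → ℝ, IsProj w E h → ∀ i, |h i - 1| ≤ η₀ := by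
  obtain ⟨D, L, hD, hL, hev⟩ := hw.exists_regime
  set M := volume.real (hpoly w fun _ => 1) with hM
  have t1 : Tendsto (fun η : ℝ => 2 ^ n * (((1 + 4 * η) ^ n - (1 - 4 * η) ^ n) *
      (1 / D + M * 2 ^ n / D ^ 2) * (2 * L))) (𝓝[>] 0) (𝓝 0) := by
    have := (((tendsto_pow_sub_pow n 4).mul_const (1 / D + M * 2 ^ n / D ^ 2)).mul_const
      (2 * L)).const_mul (2 ^ n)
    simpa using this
  have t2 : Tendsto (fun η : ℝ => ((1 + 4 * η) ^ n - (1 - 4 * η) ^ n) * M / D)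
      (𝓝[>] 0) (𝓝 0) := by
    have := ((tendsto_pow_sub_pow n 4).mul_const M).div_const D
    simpa using this
  -- Order of choices: η for the contraction, then the cap volume v for this η, then ε₁ small in
  -- terms of both.
  obtain ⟨η, ⟨⟨H, hη⟩, hη1⟩, hη2⟩ := (((hev.and (Ioo_mem_nhdsGT hη₀)).and (t1.eventually (ge_mem_nhds
    (show (0 : ℝ) < 1 / 2 by norm_num)))).and (t2.eventually (ge_mem_nhds
    (show (0 : ℝ) < 1 / 2 by norm_num)))).exists
  have hη0 := H.pos
  obtain ⟨v, hv0, hv⟩ := hw.exists_cap_volume hη0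
  have t3 : Tendsto (fun ε : ℝ => 2 ^ n * (((1 + ε) ^ n - (1 - ε) ^ n) * M / D))
      (𝓝[>] 0) (𝓝 0) := by
    have := (((tendsto_pow_sub_pow n 1).mul_const M).div_const D).const_mul (2 ^ n)
    simpa using this
  have t4 : Tendsto (fun ε : ℝ => ((1 + ε) ^ n - 1) * M) (𝓝[>] 0) (𝓝 0) := by
    have : Continuous fun ε : ℝ => ((1 + ε) ^ n - 1) * M := by fun_prop
    have h := this.tendsto 0
    simp only [add_zero, one_pow, sub_self, zero_mul] at h
    exact h.mono_left nhdsWithin_le_nhds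
  obtain ⟨ε₁, ⟨h1, h2⟩, h3⟩ := (((t3.eventually (ge_mem_nhds (half_pos hη0))).and
    (t4.eventually (gt_mem_nhds hv0))).and (Ioo_mem_nhdsGT hη0)).exists
  refine ⟨ε₁, h3.1, fun ε hε hεε E hEm hE1 hE2 hvol => ?_⟩
  have hE1' : hpoly w (fun _ => 1 - ε₁) ⊆ E := (hpoly_mono fun _ => by linarith).trans hE1
  have hE2' : E ⊆ hpoly w (fun _ => 1 + ε₁) := hE2.trans (hpoly_mono fun _ => by linarith)
  have hball : ∀ h, IsProj w E h → h ∈ closedBall (1 : ι → ℝ) η := fun h hp => by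
    refine mem_closedBall.2 ((dist_pi_le_iff hη0.le).2 fun i => ?_)
    have a1 := hp.le_one_add hw hn h3.1 hE2' i
    have a2 := hp.one_sub_le hw hn h3.1 hE2' hv h2 i
    rw [Real.dist_eq, Pi.one_apply, abs_le]
    constructor <;> linarith [h3.2]
  have hex := H.existsUnique hn (by linarith [h3.2]) h3.1.le hE1' hE2' hη1 hη2 h1
  constructor
  · obtain ⟨h, ⟨hh, hr⟩, huniq⟩ := hex
    exact ⟨h, (H.isProj_iff hEm hvol hh).2 hr, fun h' hp =>
      huniq h' ⟨hball h' hp, (H.isProj_iff hEm hvol (hball h' hp)).1 hp⟩⟩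
  · exact fun h hp i => (abs_sub_one_le (hball h hp) i).trans hη.2.le

end Projection

section Potential

variable {n : ℕ} {ι : Type*} {w : ι → Eu n} {g : Eu n → ℝ}

/-! ### The potential of sets close to a polytope -/

/-- 1/g is at most a multiple of 1/‖x‖, whose radial integrand is r^(n-2). -/
lemma integrableOn_inv_gauge [Finite ι] (hn : 2 ≤ n)
    (hg : ∀ x, IsGreatest (range fun i => inner ℝ x (w i)) (g x)) (hw : Irredundant w) (R : ℝ) :
    IntegrableOn (fun x => 1 / g x) (ball 0 R) := by
  have : Nontrivial (Eu n) :=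
    Module.nontrivial_of_finrank_pos (R := ℝ) (by simp; omega)
  obtain ⟨c, hc, hle⟩ := exists_le_gauge hg hw
  have h1 : IntegrableOn (fun x : Eu n => ‖x‖⁻¹) (ball 0 R) := by
    rw [integrableOn_fun_norm_addHaar (μ := volume) (f := fun t : ℝ => t⁻¹)]
    have : IntegrableOn (fun y : ℝ => y ^ (n - 2)) (Ioo 0 R) :=
      ((by fun_prop : Continuous fun y : ℝ => y ^ (n - 2)).integrableOn_Icc).mono_set Ioo_subset_Icc_self
    refine this.congr_fun (fun y hy => ?_) measurableSet_Ioo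
    obtain ⟨k, rfl⟩ := Nat.exists_eq_add_of_le hn
    have hy0 : y ≠ 0 := hy.1.ne'
    simp only [finrank_euclideanSpace, Fintype.card_fin, smul_eq_mul]
    rw [show 2 + k - 2 = k by omega, show 2 + k - 1 = k + 1 by omega, pow_succ]
    field_simp
  refine (h1.const_mul c⁻¹).mono' ?_ (Eventually.of_forall fun x => ?_)
  · exact (measurable_const.div (continuous_gauge hg).measurable).aestronglyMeasurable
  · by_cases hx : x = 0
    · have h0 : g 0 = 0 := by simpa using gauge_smul hg le_rfl (0 : Eu n)
      simp [hx, h0]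
    have hxn := norm_pos_iff.2 hx
    rw [Real.norm_of_nonneg (one_div_nonneg.2 (gauge_pos hg hw hx).le), ← mul_inv, one_div]
    exact inv_anti₀ (by positivity) (hle x)

lemma setIntegral_translate (S : Set (Eu n)) (hS : MeasurableSet S) (y : Eu n) :
    ∫ x in S, 1 / g (x - y) = ∫ x in {x | x + y ∈ S}, 1 / g x := by
  have hS' : MeasurableSet {x | x + y ∈ S} := (measurable_add_const y) hS
  rw [← integral_indicator hS, ← integral_indicator hS',
    ← integral_add_right_eq_self (μ := volume) _ y]
  congr 1
  ext x
  by_cases hx : x + y ∈ S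
  · simp [hx]
  · simp [hx]

/-- A set of the volume of the unit polytope that lies between two of its dilates. -/
structure Close (w : ι → Eu n) (ε : ℝ) (S : Set (Eu n)) : Prop where
  meas : MeasurableSet S
  lower : hpoly w (fun _ => 1 - ε) ⊆ S
  upper : S ⊆ hpoly w fun _ => 1 + ε
  vol : volume S = volume (hpoly w fun _ => 1)

lemma Irredundant.exists_close_subset_ball [Finite ι] [Nonempty ι] (hw : Irredundant w) :
    ∃ R, 0 < R ∧ ∀ ε, ε ≤ 1 → ∀ S, Close w ε S → S ⊆ ball 0 R := by
  obtain ⟨R, hR, hsub⟩ := hw.exists_hpoly_subset_ball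
  exact ⟨R * 2, by positivity, fun ε hε S hS =>
    (hS.upper.trans (hpoly_mono fun _ => by linarith)).trans (hsub 2 two_pos)⟩

lemma translate_subset_ball {S : Set (Eu n)} {R : ℝ} (hS : S ⊆ ball 0 R) (y : Eu n) :
    {x | x + y ∈ S} ⊆ ball 0 (R + ‖y‖) := by
  intro x hx
  have h1 : ‖x + y‖ < R := mem_ball_zero_iff.1 (hS hx)
  rw [mem_ball_zero_iff]
  have h2 := norm_sub_le (x + y) y
  rw [add_sub_cancel_right] at h2
  linarith

lemma integrableOn_translate (hn : 2 ≤ n) [Finite ι]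
    (hg : ∀ x, IsGreatest (range fun i => inner ℝ x (w i)) (g x)) (hw : Irredundant w)
    {S : Set (Eu n)} {R : ℝ} (hS : S ⊆ ball 0 R) (hSm : MeasurableSet S) (y : Eu n) :
    IntegrableOn (fun x => 1 / g (x - y)) S := by
  have h1 := (integrableOn_inv_gauge hn hg hw (R + ‖y‖)).mono_set (translate_subset_ball hS y)
  have hS' : MeasurableSet {x | x + y ∈ S} := (measurable_add_const y) hSm
  rw [← integrable_indicator_iff hS'] at h1
  have h2 := h1.comp_sub_right y
  rw [← integrable_indicator_iff hSm]
  refine h2.congr (Eventually.of_forall fun x => ?_)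
  by_cases hx : x ∈ S
  · simp [hx]
  · simp [hx]

/-- For small translations the potentials of two sets close to the polytope are comparable. -/
lemma abs_setIntegral_sub_le (hn : 2 ≤ n) [Finite ι] [Nonempty ι]
    (hg : ∀ x, IsGreatest (range fun i => inner ℝ x (w i)) (g x)) (hw : Irredundant w)
    {E A : Set (Eu n)} {ε : ℝ} (hε : ε ≤ 1 / 6) (hE : Close w ε E) (hA : Close w ε A)
    {y : Eu n} (hy : g y ≤ 1 / 6) (hy' : g (-y) ≤ 1 / 6) :
    |(∫ x in E, 1 / g (x - y)) - ∫ x in A, 1 / g (x - y)| ≤ 1 / 2 * volume.real (E ∆ A) := by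
  obtain ⟨R, hR, hball⟩ := hw.exists_close_subset_ball
  have hEb := hball ε (by linarith) E hE
  have hAb := hball ε (by linarith) A hA
  have hfE : volume E ≠ ⊤ := hE.vol ▸ (hw.volume_hpoly_lt_top _).ne
  have hfA : volume A ≠ ⊤ := hA.vol ▸ (hw.volume_hpoly_lt_top _).ne
  have hiE := integrableOn_translate hn hg hw hEb hE.meas y
  have hiA := integrableOn_translate hn hg hw hAb hA.meas y
  have hcE : IntegrableOn (fun _ : Eu n => (1 : ℝ)) E := integrableOn_const hfE
  have hcA : IntegrableOn (fun _ : Eu n => (1 : ℝ)) A := integrableOn_const hfA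
  have hvol : volume.real E = volume.real A := by
    rw [measureReal_def, measureReal_def, hE.vol, hA.vol]
  have hφE : ∫ x in E, (1 / g (x - y) - 1) = (∫ x in E, 1 / g (x - y)) - volume.real E := by
    rw [integral_sub hiE hcE]; simp
  have hφA : ∫ x in A, (1 / g (x - y) - 1) = (∫ x in A, 1 / g (x - y)) - volume.real A := by
    rw [integral_sub hiA hcA]; simp
  have hEAm : MeasurableSet (E ∆ A) := hE.meas.symmDiff hA.meas
  have hfEA : volume (E ∆ A) ≠ ⊤ := measure_ne_top_of_subset symmDiff_subset_union
    (measure_union_ne_top hfE hfA)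
  have iE : Integrable (E.indicator fun x => 1 / g (x - y) - 1) volume :=
    (integrable_indicator_iff hE.meas).2 (hiE.sub hcE)
  have iA : Integrable (A.indicator fun x => 1 / g (x - y) - 1) volume :=
    (integrable_indicator_iff hA.meas).2 (hiA.sub hcA)
  -- Since |E| = |A|, the integrand may be replaced by 1/g(x-y) - 1; then only E Δ A contributes.
  have key : (∫ x in E, 1 / g (x - y)) - ∫ x in A, 1 / g (x - y) =
      ∫ x, (E.indicator (fun x => 1 / g (x - y) - 1) x -
        A.indicator (fun x => 1 / g (x - y) - 1) x) := by
    rw [integral_sub iE iA, integral_indicator hE.meas,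
      integral_indicator hA.meas, hφE, hφA, hvol]
    ring
  rw [key, ← Real.norm_eq_abs]
  have hb : ∫ x, (E ∆ A).indicator (fun _ => (1 / 2 : ℝ)) x = 1 / 2 * volume.real (E ∆ A) := by
    rw [integral_indicator hEAm]; simp [mul_comm]
  rw [← hb]
  refine norm_integral_le_of_norm_le
    ((integrable_indicator_iff hEAm).2 (integrableOn_const hfEA)) (Eventually.of_forall fun x => ?_)
  have hbd : x ∈ E ∆ A → |1 / g (x - y) - 1| ≤ 1 / 2 := by
    intro hx
    have h1 : g x < 7 / 6 := by
      refine (gauge_lt_iff hg).2 (hpoly_mono (fun _ => ?_) (hx.elim (fun h => hE.upper h.1)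
        fun h => hA.upper h.1))
      linarith
    have h2 : 5 / 6 ≤ g x := by
      by_contra! hlt
      have hmem : x ∈ hpoly w fun _ => 1 - ε :=
        hpoly_mono (fun _ => by linarith) ((gauge_lt_iff hg).1 hlt)
      exact hx.elim (fun h => h.2 (hA.lower hmem)) fun h => h.2 (hE.lower hmem)
    have h3 := gauge_add_le hg (x - y) y
    have h4 := gauge_add_le hg x (-y)
    rw [sub_add_cancel] at h3
    rw [← sub_eq_add_neg] at h4
    -- From 2/3 ≤ g(x-y) ≤ 4/3 it follows that 1/g(x-y) - 1 lies in [-1/4, 1/2]; this is the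
    -- constant 1/2 of the theorem.
    have h5 : 2 / 3 ≤ g (x - y) := by linarith
    have h6 : g (x - y) ≤ 4 / 3 := by linarith
    have h7 : 0 < g (x - y) := by linarith
    rw [abs_le, le_sub_iff_add_le, sub_le_iff_le_add, le_div_iff₀ h7, div_le_iff₀ h7]
    constructor <;> linarith
  by_cases h1 : x ∈ E <;> by_cases h2 : x ∈ A
  · simp [h1, h2, mem_symmDiff]
  · have hx : x ∈ E ∆ A := Or.inl ⟨h1, h2⟩
    simpa [h1, h2, hx] using hbd hx
  · have hx : x ∈ E ∆ A := Or.inr ⟨h2, h1⟩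
    have := hbd hx
    rw [abs_sub_comm] at this
    simpa [h1, h2, hx] using this
  · simp [h1, h2, mem_symmDiff]

/-- The translation of a set close to the polytope by a vector bounded away from zero contains a
ball of fixed size well outside the polytope. -/
lemma exists_ball_translate [Finite ι] [Nonempty ι]
    (hg : ∀ x, IsGreatest (range fun i => inner ℝ x (w i)) (g x)) (hw : Irredundant w)
    {δ : ℝ} (hδ : 0 < δ) : ∃ τ r : ℝ, 0 < τ ∧ 0 < r ∧ ∀ y : Eu n, δ ≤ ‖y‖ → ∃ p : Eu n,
      ∀ z ∈ ball p r, 1 + 3 * τ < g z ∧ g (z + y) < 1 - τ := by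
  obtain ⟨c, hc, hle⟩ := exists_le_gauge hg hw
  obtain ⟨C, hC, hge⟩ := exists_gauge_le hg
  set τ := min (c * δ) 1 / 6 with hτ
  have hτ0 : 0 < τ := by positivity
  have hτ1 : 6 * τ ≤ 1 := by rw [hτ]; linarith [min_le_right (c * δ) 1]
  have hτ2 : 6 * τ ≤ c * δ := by rw [hτ]; linarith [min_le_left (c * δ) 1]
  refine ⟨τ, τ / C, hτ0, by positivity, fun y hy => ?_⟩
  have hG : c * δ ≤ g (-y) := by
    refine le_trans ?_ (hle (-y))
    rw [norm_neg]
    exact mul_le_mul_of_nonneg_left hy hc.le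
  set T := g (-y) with hT
  have hT0 : 0 < T := by linarith [mul_pos hc hδ]
  set e := T⁻¹ • (-y) with he
  have hge1 : g e = 1 := by
    rw [he, gauge_smul hg (inv_nonneg.2 hT0.le), ← hT, inv_mul_cancel₀ hT0.ne']
  have hy' : y = -(T • e) := by
    rw [he, smul_smul, mul_inv_cancel₀ hT0.ne', one_smul, neg_neg]
  -- The centre is the point (1 - 2τ)e just inside K, moved by -y = T e. As T ≥ 6τ, its gauge is at
  -- least 1 + 4τ, and the ball has gauge radius at most τ.
  refine ⟨(T + (1 - 2 * τ)) • e, fun z hz => ?_⟩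
  set v := z - (T + (1 - 2 * τ)) • e with hv
  have hvn : C * ‖v‖ < τ := by
    rw [mem_ball, dist_eq_norm, lt_div_iff₀ hC] at hz
    linarith
  have hgv := (abs_le.1 (hge v)).2
  have hgv' := (abs_le.1 (hge (-v))).2
  rw [norm_neg] at hgv'
  constructor
  · have h1 := gauge_add_le hg z (-v)
    have h2 : z + -v = (T + (1 - 2 * τ)) • e := by rw [hv]; abel
    rw [h2, gauge_smul hg (by linarith), hge1] at h1
    linarith
  · have h2 : z + y = (1 - 2 * τ) • e + v := by
      rw [hv, hy', add_smul]; abel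
    have h1 := gauge_add_le hg ((1 - 2 * τ) • e) v
    rw [← h2, gauge_smul hg (by linarith), hge1] at h1
    linarith

/-- Let F = E - y and compare the integrals of 1/g - 1 over E and F. The ball lies in F and outside
E and gains at least κ times its volume. Elsewhere, points of E \ F and F \ E lose at most 2ε each,
because E is almost a sublevel set of g; the total loss is at most 4ε|K|. -/
lemma setIntegral_le_of_far (hn : 2 ≤ n) [Finite ι] [Nonempty ι]
    (hg : ∀ x, IsGreatest (range fun i => inner ℝ x (w i)) (g x)) (hw : Irredundant w)
    {E : Set (Eu n)} {ε τ r : ℝ} (hτ : 0 < τ) (hε0 : 0 < ε) (hε : ε ≤ 1 / 2) (hετ : ε ≤ τ)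
    (hE : Close w ε E) {y p : Eu n}
    (hp : ∀ z ∈ ball p r, 1 + 3 * τ < g z ∧ g (z + y) < 1 - τ)
    (hsmall : 4 * ε * volume.real (hpoly w fun _ => 1) ≤
      (1 - 1 / (1 + 3 * τ)) * volume.real (ball p r)) :
    ∫ x in E, 1 / g (x - y) ≤ ∫ x in E, 1 / g x := by
  have : Nontrivial (Eu n) :=
    Module.nontrivial_of_finrank_pos (R := ℝ) (by simp; omega)
  obtain ⟨R, hR, hball⟩ := hw.exists_close_subset_ball
  have hEb := hball ε (by linarith) E hE
  rw [setIntegral_translate E hE.meas]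
  set F := {x | x + y ∈ E} with hF
  have hFm : MeasurableSet F := (measurable_add_const y) hE.meas
  have hfE : volume E ≠ ⊤ := hE.vol ▸ (hw.volume_hpoly_lt_top _).ne
  have hFE : volume F = volume E := measure_preimage_add_right volume y E
  have hfF : volume F ≠ ⊤ := hFE ▸ hfE
  have hiE : IntegrableOn (fun x => 1 / g x) E := (integrableOn_inv_gauge hn hg hw R).mono_set hEb
  have hiF : IntegrableOn (fun x => 1 / g x) F :=
    (integrableOn_inv_gauge hn hg hw _).mono_set (translate_subset_ball hEb y)
  have hcE : IntegrableOn (fun _ : Eu n => (1 : ℝ)) E := integrableOn_const hfE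
  have hcF : IntegrableOn (fun _ : Eu n => (1 : ℝ)) F := integrableOn_const hfF
  have hvol : volume.real F = volume.real E := by rw [measureReal_def, measureReal_def, hFE]
  have hvolK : volume.real E = volume.real (hpoly w fun _ => 1) := by
    rw [measureReal_def, measureReal_def, hE.vol]
  have hφE : ∫ x in E, (1 / g x - 1) = (∫ x in E, 1 / g x) - volume.real E := by
    rw [integral_sub hiE hcE]; simp
  have hφF : ∫ x in F, (1 / g x - 1) = (∫ x in F, 1 / g x) - volume.real F := by
    rw [integral_sub hiF hcF]; simp
  have iE : Integrable (E.indicator fun x => 1 / g x - 1) volume :=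
    (integrable_indicator_iff hE.meas).2 (hiE.sub hcE)
  have iF : Integrable (F.indicator fun x => 1 / g x - 1) volume :=
    (integrable_indicator_iff hFm).2 (hiF.sub hcF)
  set κ := 1 - 1 / (1 + 3 * τ) with hκ
  have iQ : Integrable ((ball p r).indicator fun _ => κ) volume :=
    (integrable_indicator_iff measurableSet_ball).2 (integrableOn_const measure_ball_lt_top.ne)
  have cE : Integrable (E.indicator fun _ => 2 * ε) volume :=
    (integrable_indicator_iff hE.meas).2 (integrableOn_const hfE)
  have cF : Integrable (F.indicator fun _ => 2 * ε) volume :=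
    (integrable_indicator_iff hFm).2 (integrableOn_const hfF)
  have cEF : Integrable (fun x => E.indicator (fun _ => 2 * ε) x +
    F.indicator (fun _ => 2 * ε) x) volume := cE.add cF
  have hmono : ∫ x, ((ball p r).indicator (fun _ => κ) x -
      (E.indicator (fun _ => 2 * ε) x + F.indicator (fun _ => 2 * ε) x)) ≤
      ∫ x, (E.indicator (fun x => 1 / g x - 1) x - F.indicator (fun x => 1 / g x - 1) x) := by
    refine integral_mono_ae (iQ.sub cEF) (iE.sub iF) ?_
    have h0 : ∀ᵐ x : Eu n, x ≠ 0 := by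
      rw [ae_iff]; simp
    filter_upwards [h0] with x hx
    have hgx := gauge_pos hg hw hx
    have hEup : x ∈ E → -(2 * ε) ≤ 1 / g x - 1 := fun h => by
      have h1 : g x < 1 + ε := (gauge_lt_iff hg).2 (hE.upper h)
      rw [le_sub_iff_add_le, le_div_iff₀ hgx]
      nlinarith
    have hElow : x ∉ E → 1 / g x - 1 ≤ 2 * ε := fun h => by
      have h1 : 1 - ε ≤ g x := by
        by_contra! hlt
        exact h (hE.lower ((gauge_lt_iff hg).1 hlt))
      rw [sub_le_iff_le_add, div_le_iff₀ hgx]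
      nlinarith
    by_cases hQ : x ∈ ball p r
    · obtain ⟨h1, h2⟩ := hp x hQ
      have hxE : x ∉ E := fun h => by
        have : g x < 1 + ε := (gauge_lt_iff hg).2 (hE.upper h)
        linarith
      have hxF : x ∈ F := hE.lower ((gauge_lt_iff hg).1 (by linarith))
      have h3 : 1 / g x ≤ 1 / (1 + 3 * τ) := one_div_le_one_div_of_le (by linarith) h1.le
      simp only [hQ, hxE, hxF, indicator_of_mem, indicator_of_notMem, not_false_eq_true]
      linarith
    · by_cases hxE : x ∈ E <;> by_cases hxF : x ∈ F
      · simp only [hQ, hxE, hxF, indicator_of_mem, indicator_of_notMem, not_false_eq_true]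
        linarith
      · have := hEup hxE
        simp only [hQ, hxE, hxF, indicator_of_mem, indicator_of_notMem, not_false_eq_true]
        linarith
      · have := hElow hxE
        simp only [hQ, hxE, hxF, indicator_of_mem, indicator_of_notMem, not_false_eq_true]
        linarith
      · simp only [hQ, hxE, hxF, indicator_of_notMem, not_false_eq_true]
        linarith
  rw [integral_sub iE iF, integral_indicator hE.meas, integral_indicator hFm, hφE, hφF,
    integral_sub iQ cEF, integral_add cE cF, integral_indicator hE.meas,
    integral_indicator hFm, integral_indicator measurableSet_ball] at hmono
  simp only [setIntegral_const, smul_eq_mul] at hmono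
  rw [hvol, hvolK] at hmono
  linarith

/-- The suprema of the potentials of two sets close to the polytope are comparable. -/
theorem Irredundant.exists_potential_close (hn : 2 ≤ n) [Finite ι] [Nonempty ι]
    (hg : ∀ x, IsGreatest (range fun i => inner ℝ x (w i)) (g x)) (hw : Irredundant w) :
    ∃ ε₂ : ℝ, 0 < ε₂ ∧ ∀ E A, Close w ε₂ E → Close w ε₂ A →
      |(⨆ y, ∫ x in E, 1 / g (x - y)) - ⨆ y, ∫ x in A, 1 / g (x - y)| ≤
        1 / 2 * volume.real (E ∆ A) := by
  obtain ⟨C, hC, hge⟩ := exists_gauge_le hg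
  -- The threshold 1/(6C) separates the two regimes: below it g(±y) ≤ 1/6, as the comparison at
  -- small y requires.
  obtain ⟨τ, r, hτ, hr, hfar⟩ := exists_ball_translate hg hw (δ := 1 / (6 * C)) (by positivity)
  set M := volume.real (hpoly w fun _ => 1) with hM
  set κ := 1 - 1 / (1 + 3 * τ) with hκ
  have hκ0 : 0 < κ := by
    rw [hκ, sub_pos, div_lt_one (by linarith)]; linarith
  set b := volume.real (ball (0 : Eu n) r) with hb
  have hb0 : 0 < b := ENNReal.toReal_pos (measure_ball_pos volume _ hr).ne' measure_ball_lt_top.ne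
  set ε := min (min (1 / 6) τ) (κ * b / (4 * (M + 1))) with hε
  have hM0 : 0 ≤ M := measureReal_nonneg
  have hε0 : 0 < ε := by positivity
  have hε1 : ε ≤ 1 / 6 := (min_le_left _ _).trans (min_le_left _ _)
  have hε2 : ε ≤ τ := (min_le_left _ _).trans (min_le_right _ _)
  have hε3 : 4 * ε * M ≤ κ * b := by
    have : ε ≤ κ * b / (4 * (M + 1)) := min_le_right _ _
    rw [le_div_iff₀ (by positivity)] at this
    nlinarith
  obtain ⟨R, hR, hball⟩ := hw.exists_close_subset_ball
  have hbig : ∀ S, Close w ε S → ∀ y : Eu n, 1 / (6 * C) ≤ ‖y‖ →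
      ∫ x in S, 1 / g (x - y) ≤ ∫ x in S, 1 / g x := by
    intro S hS y hy
    obtain ⟨p, hp⟩ := hfar y hy
    refine setIntegral_le_of_far hn hg hw hτ hε0 (by linarith) hε2 hS hp ?_
    have : volume.real (ball p r) = b := by
      rw [measureReal_def, Measure.addHaar_ball_center, ← measureReal_def]
    rw [this]
    exact hε3
  have hnn : ∀ x, 0 ≤ 1 / g x := fun x => by
    by_cases hx : x = 0
    · have h0 : g 0 = 0 := by simpa using gauge_smul hg le_rfl (0 : Eu n)
      simp [hx, h0]
    · exact one_div_nonneg.2 (gauge_pos hg hw hx).le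
  -- Boundedness is needed because an unbounded real supremum takes the default value 0.
  have hbdd : ∀ S, Close w ε S → BddAbove (range fun y => ∫ x in S, 1 / g (x - y)) := by
    intro S hS
    have hSb := hball ε (by linarith) S hS
    refine ⟨∫ x in ball 0 (R + 1 / (6 * C)), 1 / g x, ?_⟩
    rintro _ ⟨y, rfl⟩
    have hint := integrableOn_inv_gauge hn hg hw (R + 1 / (6 * C))
    rcases le_total (1 / (6 * C)) ‖y‖ with h | h
    · refine (hbig S hS y h).trans (setIntegral_mono_set hint (Eventually.of_forall hnn) ?_)
      exact (hSb.trans (ball_subset_ball (by linarith [show 0 < 1 / (6 * C) by positivity]))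
        ).eventuallyLE
    · change ∫ x in S, 1 / g (x - y) ≤ _
      rw [setIntegral_translate S hS.meas]
      refine setIntegral_mono_set hint (Eventually.of_forall hnn) ?_
      exact ((translate_subset_ball hSb y).trans (ball_subset_ball (by linarith))).eventuallyLE
  have hone : ∀ E A, Close w ε E → Close w ε A → (⨆ y, ∫ x in E, 1 / g (x - y)) ≤
      (⨆ y, ∫ x in A, 1 / g (x - y)) + 1 / 2 * volume.real (E ∆ A) := by
    intro E A hE hA
    have hnear : ∀ y : Eu n, ‖y‖ ≤ 1 / (6 * C) → ∫ x in E, 1 / g (x - y) ≤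
        (⨆ y, ∫ x in A, 1 / g (x - y)) + 1 / 2 * volume.real (E ∆ A) := by
      intro y hy
      have hCy : C * ‖y‖ ≤ 1 / 6 := by
        rw [le_div_iff₀ (by positivity)] at hy; linarith
      have h1 := (abs_le.1 (hge y)).2
      have h2 := (abs_le.1 (hge (-y))).2
      rw [norm_neg] at h2
      have h3 := abs_setIntegral_sub_le hn hg hw hε1 hE hA (h1.trans hCy) (h2.trans hCy)
      have h4 := le_ciSup (hbdd A hA) y
      linarith [(abs_le.1 h3).2]
    refine ciSup_le fun y => ?_
    rcases le_total (1 / (6 * C)) ‖y‖ with h | h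
    · refine (hbig E hE y h).trans ?_
      have := hnear 0 (by rw [norm_zero]; positivity)
      simpa using this
    · exact hnear y h
  refine ⟨ε, hε0, fun E A hE hA => ?_⟩
  have h1 := hone E A hE hA
  have h2 := hone A E hA hE
  rw [symmDiff_comm] at h2
  rw [abs_le]
  constructor <;> linarith

end Potential

section Density

variable {n : ℕ} {f : Eu n → ℝ}

/-! ### Consequences of the density estimate -/

lemma eccentricity_pos (hf : IsCrystalline f) (hn : 2 ≤ n) : 0 < eccentricity f := by
  have : Nontrivial (Eu n) :=
    Module.nontrivial_of_finrank_pos (R := ℝ) (by simp; omega)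
  obtain ⟨V, hV⟩ := hf.2
  have hK : IsCompact (f '' sphere (0 : Eu n) 1) :=
    (isCompact_sphere (0 : Eu n) 1).image (Represents.continuous hV)
  have hne : (f '' sphere (0 : Eu n) 1).Nonempty :=
    (NormedSpace.sphere_nonempty.2 zero_le_one).image f
  have hpos : ∀ t ∈ f '' sphere (0 : Eu n) 1, 0 < t := by
    rintro _ ⟨ν, hν, rfl⟩
    exact hf.1 ν (norm_ne_zero_iff.1 (by rw [mem_sphere_zero_iff_norm.1 hν]; exact one_ne_zero))
  exact div_pos (hpos _ (hK.sInf_mem hne)) (hpos _ (hK.sSup_mem hne))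

variable {ι : Type*} {w : ι → Eu n} {r₀ c : ℝ} {E : Set (Eu n)}

lemma Irredundant.ne_zero (hw : Irredundant w) (i : ι) : w i ≠ 0 := by
  intro h
  obtain ⟨p, hp, _⟩ := hw.slack i
  rw [h, inner_zero_right] at hp
  exact zero_ne_one hp

/-- A set with density estimates that is close in volume to a polytope lies, up to a null set,
between two dilates of the polytope. -/
theorem exists_close_ae_eq [Fintype ι] (hw : Irredundant w) (hr₀ : 0 < r₀) (hc : 0 < c) {ε : ℝ} (hε : 0 < ε)
    (hε1 : ε ≤ 1 / 2) :
    ∃ ε₀ : ℝ, 0 < ε₀ ∧ ∀ E : Set (Eu n), HasFinitePerimeter E →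
      (∀ x ∈ reducedBoundary E, ∀ r : ℝ, 0 < r → r < r₀ →
        c * volume.real (ball x r) ≤ volume.real (ball x r ∩ E) ∧
        volume.real (ball x r ∩ E) ≤ (1 - c) * volume.real (ball x r)) →
      volume E = volume (hpoly w fun _ => 1) →
      volume (E ∆ hpoly w fun _ => 1) ≤ ENNReal.ofReal ε₀ →
      ∃ E', Close w ε E' ∧ E =ᵐ[volume] E' := by
  set B := ∑ i, ‖w i‖ + 1 with hB
  have hB0 : 0 < B := by positivity
  have hBi : ∀ i, ∀ v : Eu n, |inner ℝ v (w i)| ≤ B * ‖v‖ := fun i v => by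
    refine (abs_real_inner_le_norm _ _).trans ?_
    rw [mul_comm]
    have := Finset.single_le_sum (fun i _ => norm_nonneg (w i)) (Finset.mem_univ i)
    gcongr
    linarith
  -- Within distance r every ⟨·, w i⟩ changes by at most ε/2, so r-balls about points of `U` stay in
  -- K and those about points of `H i` avoid K.
  obtain ⟨r, hr, hrr₀, hrB⟩ : ∃ r, 0 < r ∧ r < r₀ ∧ B * r ≤ ε / 2 := by
    refine ⟨min (r₀ / 2) (ε / 2 / B), by positivity, (min_le_left _ _).trans_lt (by linarith), ?_⟩
    have := min_le_right (r₀ / 2) (ε / 2 / B)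
    rwa [le_div_iff₀' hB0] at this
  have hnear : ∀ x y : Eu n, y ∈ ball x r → ∀ i, |inner ℝ y (w i) - inner ℝ x (w i)| ≤ ε / 2 := by
    intro x y hy i
    rw [← inner_sub_left]
    rw [mem_ball, dist_eq_norm] at hy
    exact (hBi i _).trans (le_trans (by gcongr) hrB)
  set b := volume.real (ball (0 : Eu n) r) with hb
  have hb0 : 0 < b := ENNReal.toReal_pos (measure_ball_pos volume _ hr).ne' measure_ball_lt_top.ne
  have hball : ∀ x : Eu n, volume.real (ball x r) = b := fun x => by
    rw [measureReal_def, Measure.addHaar_ball_center, ← measureReal_def]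
  -- Less than c b, to contradict the density estimate, and less than b, to exclude the wrong
  -- alternative of `null_or_full` by a test ball.
  refine ⟨min c 1 * b / 2, by positivity, fun E hE hdens hvol hclose => ?_⟩
  set K := hpoly w fun _ => 1 with hK
  set ε₀ := min c 1 * b / 2 with hε₀
  have hε₀c : ε₀ < c * b := by
    have := mul_le_mul_of_nonneg_right (min_le_left c 1) hb0.le
    have := mul_pos hc hb0
    linarith
  have hε₀b : ε₀ < b := by
    have := mul_le_mul_of_nonneg_right (min_le_right c 1) hb0.le
    linarith
  have hfinEK : volume (E ∆ K) ≠ ⊤ := (hclose.trans_lt ENNReal.ofReal_lt_top).ne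
  have hEK : ∀ S ⊆ E ∆ K, volume.real S ≤ ε₀ := fun S hS =>
    (measureReal_mono hS hfinEK).trans (ENNReal.toReal_le_of_le_ofReal (by positivity) hclose)
  have hEm : NullMeasurableSet E volume := hE.1
  set U := hpoly w fun _ => 1 - ε with hU
  let H : ι → Set (Eu n) := fun i => {x | 1 + ε / 2 < inner ℝ x (w i)}
  have hUdisj : Disjoint U (reducedBoundary E) := by
    refine Set.disjoint_left.2 fun x hx hxE => ?_
    have h1 := (hdens x hxE r hr hrr₀).2
    have h2 := measureReal_inter_add_sdiff₀ (μ := volume) (s := ball x r) hEm measure_ball_lt_top.ne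
    have h3 := hEK (ball x r \ E) fun y hy => Or.inr ⟨fun i => by
      have := (abs_le.1 (hnear x y hy.1 i)).2
      have := hx i
      linarith, hy.2⟩
    rw [hball] at h1 h2
    linarith
  have hHdisj : ∀ i, Disjoint (H i) (reducedBoundary E) := by
    refine fun i => Set.disjoint_left.2 fun x (hx : 1 + ε / 2 < inner ℝ x (w i)) hxE => ?_
    have h1 := (hdens x hxE r hr hrr₀).1
    have h3 := hEK (ball x r ∩ E) fun y hy => Or.inl ⟨hy.2, fun hyK => by
      have := (abs_le.1 (hnear x y hy.1 i)).1
      have := hyK i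
      linarith⟩
    rw [hball] at h1
    linarith
  have hUE : volume (U \ E) = 0 := by
    refine (hE.null_or_full hUdisj (isOpen_hpoly w _) (convex_hpoly w _)).resolve_left fun h0 => ?_
    have hsub : ball (0 : Eu n) r ⊆ U := fun y hy i => by
      have := (abs_le.1 (hnear 0 y hy i)).2
      rw [inner_zero_left] at this
      linarith
    have h2 := measureReal_inter_add_sdiff₀ (μ := volume) (s := ball (0 : Eu n) r) hEm
      measure_ball_lt_top.ne
    have h3 := hEK (ball 0 r \ E) fun y hy => Or.inr ⟨hpoly_mono (fun _ => by linarith)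
      (hsub hy.1), hy.2⟩
    have h4 : volume.real (ball 0 r ∩ E) = 0 := by
      rw [measureReal_def, measure_mono_null
        (show ball 0 r ∩ E ⊆ E ∩ U from fun y hy => ⟨hy.2, hsub hy.1⟩) h0,
        ENNReal.toReal_zero]
    linarith
  have hHE : ∀ i, volume (E ∩ H i) = 0 := by
    intro i
    have hHc : Convex ℝ (H i) := by
      intro x (hx : 1 + ε / 2 < inner ℝ x (w i)) y (hy : 1 + ε / 2 < inner ℝ y (w i)) s t hs ht hst
      change 1 + ε / 2 < _
      rw [inner_add_left, real_inner_smul_left, real_inner_smul_left]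
      have e : 1 + ε / 2 = s * (1 + ε / 2) + t * (1 + ε / 2) := by rw [← add_mul, hst, one_mul]
      rw [e]
      rcases hs.eq_or_lt with rfl | hs
      · have : t = 1 := by linarith
        subst this; linarith
      · exact add_lt_add_of_lt_of_le (mul_lt_mul_of_pos_left hx hs)
          (mul_le_mul_of_nonneg_left hy.le ht)
    refine (hE.null_or_full (hHdisj i) (isOpen_lt continuous_const (by fun_prop)) hHc).resolve_right
      fun h0 => ?_
    have hwi := norm_pos_iff.2 (hw.ne_zero i)
    -- The centre of a test ball lying in `H i` and disjoint from K.
    set x := (2 / ‖w i‖ ^ 2) • w i with hx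
    have hxi : inner ℝ x (w i) = 2 := by
      rw [hx, real_inner_smul_left, real_inner_self_eq_norm_sq]; field_simp
    have hsub : ∀ y ∈ ball x r, 1 + ε / 2 < inner ℝ y (w i) := fun y hy => by
      have := (abs_le.1 (hnear x y hy i)).1
      linarith
    have h2 := measureReal_inter_add_sdiff₀ (μ := volume) (s := ball x r) hEm measure_ball_lt_top.ne
    have h3 := hEK (ball x r ∩ E) fun y hy => Or.inl ⟨hy.2, fun hyK => by
      have h5 := hsub y hy.1
      have h6 := hyK i
      linarith⟩
    have h4 : volume.real (ball x r \ E) = 0 := by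
      rw [measureReal_def, measure_mono_null
        (show ball x r \ E ⊆ H i \ E from fun y hy => ⟨hsub y hy.1, hy.2⟩) h0,
        ENNReal.toReal_zero]
    rw [hball] at h2
    linarith
  obtain ⟨E₀, hE₀m, hE₀⟩ : ∃ E₀, MeasurableSet E₀ ∧ E =ᵐ[volume] E₀ := hEm
  -- The representative E' is a measurable version of E with (1-ε)K added and everything outside
  -- (1+ε)K removed; both operations change it by null sets only.
  have hae : E =ᵐ[volume] ((E₀ ∪ U) ∩ hpoly w fun _ => 1 + ε : Set (Eu n)) := by
    have a1 : ∀ᵐ x, ¬ x ∈ U \ E := by rw [ae_iff]; simp only [not_not]; exact hUE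
    have a2 : ∀ᵐ x, ∀ i, ¬ x ∈ E ∩ H i := by
      refine ae_all_iff.2 fun i => ?_
      rw [ae_iff]; simp only [not_not]; exact hHE i
    filter_upwards [hE₀.mem_iff, a1, a2] with x h1 h2 h3
    refine propext ?_
    change x ∈ E ↔ x ∈ (E₀ ∪ U) ∩ hpoly w fun _ => 1 + ε
    constructor
    · refine fun hx => ⟨Or.inl (h1.1 hx), fun i => ?_⟩
      have h4 : ¬ 1 + ε / 2 < inner ℝ x (w i) := fun h => h3 i ⟨hx, h⟩
      linarith
    · rintro ⟨hx | hx, _⟩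
      · exact h1.2 hx
      · by_contra hxE
        exact h2 ⟨hx, hxE⟩
  refine ⟨_, ⟨?_, ?_, inter_subset_right, ?_⟩, hae⟩
  · exact (hE₀m.union (isOpen_hpoly w _).measurableSet).inter (isOpen_hpoly w _).measurableSet
  · exact subset_inter subset_union_right (hpoly_mono fun _ => by linarith)
  · rw [← measure_congr hae, hvol]

lemma Close.mono {ε ε' : ℝ} (h : Close w ε E) (hε : ε ≤ ε') : Close w ε' E :=
  ⟨h.meas, (hpoly_mono fun _ => by linarith).trans h.lower,
    h.upper.trans (hpoly_mono fun _ => by linarith), h.vol⟩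

lemma isProj_congr {E' : Set (Eu n)} (h : E =ᵐ[volume] E') (a : ι → ℝ) :
    IsProj w E a ↔ IsProj w E' a := by
  have hv : ∀ i, volume (E ∩ sector w a i) = volume (E' ∩ sector w a i) := fun i =>
    measure_congr (h.inter (ae_eq_refl _))
  constructor
  · exact fun hp => ⟨hp.near, hp.slack, hp.vol, fun i => by rw [← hv]; exact hp.vol_sector i⟩
  · exact fun hp => ⟨hp.near, hp.slack, hp.vol, fun i => by rw [hv]; exact hp.vol_sector i⟩

end Density

end Crystal

/-! ### Assembly of the density, projection and potential estimates -/

theorem mainTheorem4 (n : ℕ) (hn : 2 ≤ n) (f : Crystal.Eu n → ℝ) (hf : Crystal.IsCrystalline f)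
    (r₀ c₀ : ℝ) (hr₀ : 0 < r₀) (hc₀ : 0 < c₀) (hc₀' : c₀ < 1 / 2) :
    ∃ ε₀ : ℝ, 0 < ε₀ ∧ ∀ E : Set (Crystal.Eu n), Crystal.HasFinitePerimeter E →
      Crystal.UniformDensity f r₀ c₀ E →
      volume E = volume (Crystal.wulff f) →
      volume (E ∆ Crystal.wulff f) ≤ ENNReal.ofReal ε₀ →
      (∃! a : Crystal.facetNormals f → ℝ, Crystal.IsProjection f E a) ∧
        ∀ a : Crystal.facetNormals f → ℝ, Crystal.IsProjection f E a →
          |Crystal.gammaPhi f E - Crystal.gammaPhi f (Crystal.perturbed f a)|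
            ≤ 1 / 2 * volume.real (E ∆ Crystal.perturbed f a) := by
  open Crystal in
  have := finite_index hf hn
  have := nonempty_index hf hn
  have := Fintype.ofFinite (facetNormals f)
  have hw := irredundant_facetVec hf hn
  obtain ⟨ε₂, hε₂, hpot⟩ := hw.exists_potential_close hn (isGreatest_dualGauge hf hn)
  -- The projection is required to be within ε₂ of K in its support numbers, so that K^{a*} itself
  -- satisfies the hypothesis of the potential estimate.
  obtain ⟨ε₁, hε₁, hproj⟩ := hw.exists_projection (by omega) hε₂
  have hc : 0 < c₀ * eccentricity f ^ n := mul_pos hc₀ (pow_pos (eccentricity_pos hf hn) n)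
  have hε0 : 0 < min (min ε₁ ε₂) (1 / 2) := by positivity
  obtain ⟨ε₀, hε₀, hdens⟩ := exists_close_ae_eq hw hr₀ hc hε0 (min_le_right _ _)
  refine ⟨ε₀, hε₀, fun E hE hUD hvol hclose => ?_⟩
  rw [wulff_eq_hpoly hf hn] at hvol hclose
  obtain ⟨E', hE', hae⟩ := hdens E hE hUD hvol hclose
  obtain ⟨hex, hsmall⟩ := hproj _ hε0 ((min_le_left _ _).trans (min_le_left _ _)) E' hE'.meas
    hE'.lower hE'.upper hE'.vol
  have hiff : ∀ a : facetNormals f → ℝ,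
      IsProjection f E a ↔ IsProj (facetVec f) E' fun i => 1 + a i := fun a => by
    rw [isProjection_iff hf hn, isProj_congr hae]
  constructor
  · obtain ⟨h, hh, huniq⟩ := hex
    refine ⟨fun i => h i - 1, (hiff _).2 (by simpa using hh), fun a ha => ?_⟩
    have := huniq _ ((hiff a).1 ha)
    ext i
    simp [← this]
  · intro a ha
    have hp := (hiff a).1 ha
    have habs := hsmall _ hp
    rw [perturbed_eq_hpoly hf]
    have hA : Close (facetVec f) ε₂ (hpoly (facetVec f) fun i => 1 + a i) :=
      ⟨(isOpen_hpoly _ _).measurableSet,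
        hpoly_mono fun i => by linarith [(abs_le.1 (habs i)).1],
        hpoly_mono fun i => by linarith [(abs_le.1 (habs i)).2], hp.vol⟩
    have key := hpot E' _ (hE'.mono ((min_le_left _ _).trans (min_le_right _ _))) hA
    have hg : gammaPhi f E = ⨆ y, ∫ x in E', 1 / dualGauge f (x - y) :=
      iSup_congr fun y => setIntegral_congr_set hae
    have hs : volume.real (E ∆ hpoly (facetVec f) fun i => 1 + a i) =
        volume.real (E' ∆ hpoly (facetVec f) fun i => 1 + a i) :=
      congrArg ENNReal.toReal (measure_congr (ae_eq_set_symmDiff hae (ae_eq_refl _)))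
    rw [hg, hs]
    exact key
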